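/- **Setting.** Write $[x,L]$ for the isometry $u\mapsto L(u+x)$ of $\mathbb{R}^n$ ($x\in\mathbb{R}^n$, $L\in \mathrm{O}(n)$), and let $Q([x,L])=L$. Let $\Gamma$ be a crystal group, i.e. a subgroup of the isometry group $\mathrm{I}(\mathbb{R}^n)$ that is discrete (in the compact-open topology) and has compact orbit space $\mathbb{R}^n/\Gamma$. Let $\Pi=Q(\Gamma)$ be its point group, $\mathrm{T}=\ker(Q|_\Gamma)$ its translation subgroup, $\mathcal{L}=\{x:[x,\mathrm{id}]\in\Gamma\}$, $\mathcal{L}^*=\{z\in\mathbb{R}^n: x\cdot z\in\mathbb{Z}\ \forall x\in\mathcal{L}\}$, and $\Gamma^*=\{[z,L]: z\in\mathcal{L}^*,\ L\in\Pi\}$. Let $R$ be a convex fundamental domain for $\Gamma^*$ ($R$ is open and connected, the sets $gR$, $g\in\Gamma^*$, are mutually disjoint, and $\bigcup_{g\in\Gamma^*} g\overline{R}=\mathbb{R}^n$), and let $\Omega$ be a set that meets each $\Gamma^*$-orbit in exactly one point, with $R\subset\Omega\subset\overline{R}$; $\Omega$ carries Lebesgue measure. Let $\gamma:\Pi\to\Gamma$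 be a cross-section: $Q(\gamma(L))=L$ and $\gamma(\mathrm{id})=[0,\mathrm{id}]$. For $\omega\in\mathbb{R}^n$ let $\chi_\omega^{\mathrm T}([y,\mathrm{id}])=e^{2\pi i\,\omega\cdot y}$ for $[y,\mathrm{id}]\in\mathrm{T}$, and let $\mathrm{ind}_{\mathrm T}^\Gamma\chi_\omega^{\mathrm T}$ be the induced representation on the functions $f:\Gamma\to\mathbb{C}$ with $f(gt)=\chi_\omega^{\mathrm T}(t^{-1})f(g)$ for $g\in\Gamma$, $t\in\mathrm{T}$, given by $(\mathrm{ind}(g)f)(h)=f(g^{-1}h)$. Under the identification $f\mapsto (L\mapsto f(\gamma(L)))$ with $l^2(\Pi)$ it becomes the unitary representation $U^{\chi_\omega^{\mathrm T}}$ of $\Gamma$ on $l^2(\Pi)$, $$[U^{\chi_\omega^{\mathrm T}}[x,L]\zeta](M)=\chi_\omega^{\mathrm T}\big(\gamma(M)^{-1}[x,L]\gamma(L^{-1}M)\big)\,\zeta(L^{-1}M).$$ Let $\mathscr{H}=l^2(\Pi)\otimes l^2(\mathcal{L}^*)$ (Hilbert space tensor product), and let $\tau=\int_\Omega^\oplus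 U^{\chi_\omega^{\mathrm T}}\otimes I\,d\omega$ be the unitary representation of $\Gamma$ on $L^2(\Omega;\mathscr{H})$ given by $(\tau(g)\xi)(\omega)=(U^{\chi_\omega^{\mathrm T}}(g)\otimes I)\,\xi(\omega)$. A closed subspace $K$ is invariant under a unitary representation $\pi$ if $\pi(g)K\subset K$ for all $g$, and $\pi$ is irreducible if its only closed invariant subspaces are $\{0\}$ and the whole space. A measurable field of subspaces is a family $\{W_\omega\}_{\omega\in\Omega}$ of closed subspaces of $\mathscr{H}$ such that, with $P_\omega$ the orthogonal projection onto $W_\omega$, $\omega\mapsto\langle P_\omega a,b\rangle$ is Lebesgue measurable for all $a,b\in\mathscr{H}$; $\int_\Omega^\oplus W_\omega\,d\omega$ denotes $\{\xi\in L^2(\Omega;\mathscr{H}):\xi(\omega)\in W_\omega\text{ for a.e. }\omega\}$. For an essentially bounded measurable field of operators $T_\omega$ on $\mathscr{H}$, the operator $\int_\Omega^\oplus T_\omega\,d\omega$ is $\xi\mapsto(\omega\mapsto T_\omega\xi(\omega))$. For a closed subspace $W\subset L^2(\Omega;\mathscr{H})$ let $P_W$ be the orthogonal projection onto $W$, and let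 $J_W$ be a range function associated with $W$: choose a countable dense set $\mathcal{A}\subset L^2(\Omega;\mathscr{H})$ and a representative $f(\Phi)$ of $P_W\Phi$ for each $\Phi\in\mathcal{A}$, and put $J_W(\omega)=\overline{\mathrm{span}}\{f(\Phi)(\omega):\Phi\in\mathcal{A}\}$. **Theorem.** The representation $U^{\chi_\omega^{\mathrm T}}$ is irreducible for every $\omega\in R$. Let $W$ be a closed subspace of $L^2(\Omega;\mathscr{H})$. 1. $W$ is $\tau$-invariant if and only if $W=\int_\Omega^\oplus W_\omega\,d\omega$ for some measurable field of subspaces $\{W_\omega\}$ such that $W_\omega$ is invariant under $U^{\chi_\omega^{\mathrm T}}\otimes I$ for a.e. $\omega\in\Omega$. 2. $W$ is $\tau$-invariant if and only if $W=\int_\Omega^\oplus W_\omega\,d\omega$ for some measurable field of subspaces $\{W_\omega\}$ such that, for a.e. $\omega\in\Omega$, $W_\omega=l^2(\Pi)\otimes F_\omega$ for some closed subspace $F_\omega\subset l^2(\mathcal{L}^*)$. 3. If $W$ is $\tau$-invariant, then an associated range function exists, and for every range function $J_W$ associated with $W$ (that is, for every choice of $\mathcal{A}$ and of the representatives): $J_W$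 is measurable; $W=\int_\Omega^\oplus J_W(\omega)\,d\omega$; with $P_J(\omega)$ the orthogonal projection of $\mathscr{H}$ onto $J_W(\omega)$, the $P_J(\omega)$ form an essentially bounded measurable field of operators and $P_W=\int_\Omega^\oplus P_J(\omega)\,d\omega$; for a.e. $\omega\in\Omega$, $J_W(\omega)$ is invariant under $U^{\chi_\omega^{\mathrm T}}\otimes I$ and is of the form $l^2(\Pi)\otimes F_\omega$ with $F_\omega\subset l^2(\mathcal{L}^*)$ closed; and every measurable field of subspaces $\{W_\omega\}$ with $W=\int_\Omega^\oplus W_\omega\,d\omega$ satisfies $W_\omega=J_W(\omega)$ for a.e. $\omega\in\Omega$. -/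

import Mathlib

open MeasureTheory Filter Topology
open scoped TensorProduct InnerProductSpace ENNReal

noncomputable section

namespace Crystal

/-! ### Unitary representations, invariant subspaces, irreducibility -/

section Representations

variable {G H : Type*} [Group G] [NormedAddCommGroup H] [InnerProductSpace ℂ H]

/-- The closed subspace `K` is invariant under the unitary representation `π`. -/
def IsInvariant (π : G →* (H ≃ₗᵢ[ℂ] H)) (K : ClosedSubmodule ℂ H) : Prop :=
  ∀ g : G, ∀ v ∈ K, π g v ∈ K

/-- The only closed invariant subspaces are `{0}` and the whole space. -/
def IsIrreducible (π : G →* (H ≃ₗᵢ[ℂ] H)) : Prop :=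
  ∀ K : ClosedSubmodule ℂ H, IsInvariant π K → K = ⊥ ∨ K = ⊤

end Representations

/-! ### The Hilbert space tensor product -/

section Tensor

variable (A B : Type*) [NormedAddCommGroup A] [InnerProductSpace ℂ A]
  [NormedAddCommGroup B] [InnerProductSpace ℂ B]

/-- The Hilbert space tensor product: the completion of the algebraic tensor product with respect
to the inner product with `⟪a ⊗ b, a' ⊗ b'⟫ = ⟪a, a'⟫ ⟪b, b'⟫`. -/
abbrev HilbertTensor : Type _ := UniformSpace.Completion (A ⊗[ℂ] B)

variable {A B}

/-- The elementary tensor `a ⊗ b`. -/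
def elemTensor (a : A) (b : B) : HilbertTensor A B := ((a ⊗ₜ[ℂ] b : A ⊗[ℂ] B) : HilbertTensor A B)

variable (A) in
/-- `A ⊗ F` for a closed subspace `F` of `B`, as a closed subspace of `A ⊗ B`. -/
def tensorSubspace (F : ClosedSubmodule ℂ B) : ClosedSubmodule ℂ (HilbertTensor A B) :=
  (Submodule.span ℂ {v | ∃ a : A, ∃ b ∈ F, v = elemTensor a b}).closure

variable (B) in
/-- The bounded operator `T ⊗ I` on the Hilbert space tensor product. -/
def amplCLM (T : A →L[ℂ] A) : HilbertTensor A B →L[ℂ] HilbertTensor A B :=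
  (T.rTensor B).completion

lemma amplCLM_coe (T : A →L[ℂ] A) (x : A ⊗[ℂ] B) :
    amplCLM B T (x : HilbertTensor A B) = ((T.rTensor B x : A ⊗[ℂ] B) : HilbertTensor A B) := by
  simp [amplCLM]

lemma amplCLM_elemTensor (T : A →L[ℂ] A) (a : A) (b : B) :
    amplCLM B T (elemTensor a b) = elemTensor (T a) b := by
  rw [elemTensor, amplCLM_coe]
  rfl

lemma amplCLM_mul (S T : A →L[ℂ] A) : amplCLM B (S * T) = amplCLM B S * amplCLM B T := by
  ext x
  induction x using UniformSpace.Completion.induction_on with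
  | hp => exact isClosed_eq (amplCLM B (S * T)).continuous (amplCLM B S * amplCLM B T).continuous
  | ih x => simp [amplCLM_coe, ContinuousLinearMap.rTensor_mul]

lemma amplCLM_one : amplCLM B (1 : A →L[ℂ] A) = 1 := by
  ext x
  induction x using UniformSpace.Completion.induction_on with
  | hp => exact isClosed_eq (amplCLM B (1 : A →L[ℂ] A)).continuous continuous_id
  | ih x => simp [amplCLM_coe]

lemma norm_amplCLM (u : A ≃ₗᵢ[ℂ] A) (x : HilbertTensor A B) :
    ‖amplCLM B (u : A →L[ℂ] A) x‖ = ‖x‖ := by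
  induction x using UniformSpace.Completion.induction_on with
  | hp => exact isClosed_eq (amplCLM B _).continuous.norm continuous_norm
  | ih x =>
    rw [amplCLM_coe, UniformSpace.Completion.norm_coe, UniformSpace.Completion.norm_coe]
    exact (LinearIsometry.rTensor B u.toLinearIsometry).norm_map x

lemma coe_mul_CLM (u v : A ≃ₗᵢ[ℂ] A) :
    ((u * v : A ≃ₗᵢ[ℂ] A) : A →L[ℂ] A) = (u : A →L[ℂ] A) * (v : A →L[ℂ] A) := rfl

lemma coe_one_CLM : ((1 : A ≃ₗᵢ[ℂ] A) : A →L[ℂ] A) = 1 := rfl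

variable (B) in
/-- The amplification `u ↦ u ⊗ I` of unitary operators. -/
def ampl : (A ≃ₗᵢ[ℂ] A) →* (HilbertTensor A B ≃ₗᵢ[ℂ] HilbertTensor A B) where
  toFun u :=
    { toFun := amplCLM B (u : A →L[ℂ] A)
      invFun := amplCLM B ((u⁻¹ : A ≃ₗᵢ[ℂ] A) : A →L[ℂ] A)
      map_add' := map_add _
      map_smul' := map_smul _
      left_inv := fun x => by
        have h : amplCLM B ((u⁻¹ : A ≃ₗᵢ[ℂ] A) : A →L[ℂ] A) * amplCLM B (u : A →L[ℂ] A) = 1 := by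
          rw [← amplCLM_mul, ← coe_mul_CLM, inv_mul_cancel, coe_one_CLM, amplCLM_one]
        exact DFunLike.congr_fun h x
      right_inv := fun x => by
        have h : amplCLM B (u : A →L[ℂ] A) * amplCLM B ((u⁻¹ : A ≃ₗᵢ[ℂ] A) : A →L[ℂ] A) = 1 := by
          rw [← amplCLM_mul, ← coe_mul_CLM, mul_inv_cancel, coe_one_CLM, amplCLM_one]
        exact DFunLike.congr_fun h x
      norm_map' := norm_amplCLM u }
  map_one' := by
    ext x
    exact DFunLike.congr_fun (amplCLM_one (A := A) (B := B)) x
  map_mul' u v := by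
    ext x
    exact DFunLike.congr_fun (amplCLM_mul (B := B) (u : A →L[ℂ] A) (v : A →L[ℂ] A)) x

lemma ampl_elemTensor (u : A ≃ₗᵢ[ℂ] A) (a : A) (b : B) :
    ampl B u (elemTensor a b) = elemTensor (u a) b :=
  amplCLM_elemTensor (u : A →L[ℂ] A) a b

end Tensor

/-! ### Direct integrals over a constant field of Hilbert spaces -/

section DirectIntegral

variable {X H G : Type*} [MeasurableSpace X] [NormedAddCommGroup H] [InnerProductSpace ℂ H]
  [Group G]

/-- An essentially bounded measurable field of operators on the constant field `H`: it sends
measurable vector fields to measurable vector fields and `x ↦ ‖T x‖` is essentially bounded. -/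
structure IsBoundedMeasurableField (μ : Measure X) (T : X → H →L[ℂ] H) : Prop where
  meas : ∀ ξ : X → H, AEStronglyMeasurable ξ μ → AEStronglyMeasurable (fun x => T x (ξ x)) μ
  bdd : ∃ C : ℝ, ∀ᵐ x ∂μ, ‖T x‖ ≤ C

variable {μ : Measure X}

lemma IsBoundedMeasurableField.memLp {T : X → H →L[ℂ] H} (h : IsBoundedMeasurableField μ T)
    (ξ : Lp H 2 μ) : MemLp (fun x => T x (ξ x)) 2 μ := by
  obtain ⟨C, hC⟩ := h.bdd
  refine (Lp.memLp ξ).of_le_mul (c := C) (h.meas _ (Lp.aestronglyMeasurable ξ)) ?_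
  filter_upwards [hC] with x hx
  exact (T x).le_of_opNorm_le hx _

/-- The operator `∫⊕ T x dμ(x)` on `L²(μ; H)`, given by `ξ ↦ (x ↦ T x (ξ x))`. -/
def directIntegralOp (T : X → H →L[ℂ] H) (h : IsBoundedMeasurableField μ T) :
    Lp H 2 μ →L[ℂ] Lp H 2 μ :=
  LinearMap.mkContinuousOfExistsBound
    { toFun := fun ξ => (h.memLp ξ).toLp _
      map_add' := fun ξ η => by
        rw [← MemLp.toLp_add, MemLp.toLp_eq_toLp_iff]
        filter_upwards [Lp.coeFn_add ξ η] with x hx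
        change T x ((ξ + η : Lp H 2 μ) x) = T x (ξ x) + T x (η x)
        rw [hx, Pi.add_apply, map_add]
      map_smul' := fun c ξ => by
        rw [RingHom.id_apply, ← MemLp.toLp_const_smul, MemLp.toLp_eq_toLp_iff]
        filter_upwards [Lp.coeFn_smul c ξ] with x hx
        change T x ((c • ξ : Lp H 2 μ) x) = c • T x (ξ x)
        rw [hx, Pi.smul_apply, map_smul] }
    (by
      obtain ⟨C, hC⟩ := h.bdd
      refine ⟨C, fun ξ => ?_⟩
      refine Lp.norm_le_mul_norm_of_ae_le_mul ?_
      filter_upwards [hC, (h.memLp ξ).coeFn_toLp] with x hx hx'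
      change ‖((h.memLp ξ).toLp _ : Lp H 2 μ) x‖ ≤ _
      rw [hx']
      exact (T x).le_of_opNorm_le hx _)

lemma directIntegralOp_coeFn (T : X → H →L[ℂ] H) (h : IsBoundedMeasurableField μ T)
    (ξ : Lp H 2 μ) : directIntegralOp T h ξ =ᵐ[μ] fun x => T x (ξ x) :=
  (h.memLp ξ).coeFn_toLp

/-- A field of unitary representations on the constant field `H` is measurable if each of its
operator fields is. -/
def IsMeasurableRepField (μ : Measure X) (ρ : X → G →* (H ≃ₗᵢ[ℂ] H)) : Prop :=
  ∀ g : G, IsBoundedMeasurableField μ (fun x => ((ρ x g : H ≃ₗᵢ[ℂ] H) : H →L[ℂ] H))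

lemma directIntegralRep_aux_mul (ρ : X → G →* (H ≃ₗᵢ[ℂ] H)) (h : IsMeasurableRepField μ ρ)
    (g k : G) (ξ : Lp H 2 μ) :
    directIntegralOp _ (h (g * k)) ξ = directIntegralOp _ (h g) (directIntegralOp _ (h k) ξ) := by
  apply Lp.ext
  filter_upwards [directIntegralOp_coeFn _ (h (g * k)) ξ, directIntegralOp_coeFn _ (h k) ξ,
    directIntegralOp_coeFn _ (h g) (directIntegralOp _ (h k) ξ)] with x h1 h2 h3
  rw [h1, h3, h2]
  simp

lemma directIntegralRep_aux_one (ρ : X → G →* (H ≃ₗᵢ[ℂ] H)) (h : IsMeasurableRepField μ ρ)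
    (ξ : Lp H 2 μ) : directIntegralOp _ (h 1) ξ = ξ := by
  apply Lp.ext
  filter_upwards [directIntegralOp_coeFn _ (h 1) ξ] with x h1
  rw [h1]
  simp

lemma directIntegralRep_aux_norm (ρ : X → G →* (H ≃ₗᵢ[ℂ] H)) (h : IsMeasurableRepField μ ρ)
    (g : G) (ξ : Lp H 2 μ) : ‖directIntegralOp _ (h g) ξ‖ = ‖ξ‖ := by
  rw [Lp.norm_def, Lp.norm_def]
  congr 1
  apply eLpNorm_congr_norm_ae
  filter_upwards [directIntegralOp_coeFn _ (h g) ξ] with x h1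
  rw [h1]
  simp

/-- The unitary representation `∫⊕ ρ x dμ(x)` on `L²(μ; H)`. -/
def directIntegralRep (ρ : X → G →* (H ≃ₗᵢ[ℂ] H)) (h : IsMeasurableRepField μ ρ) :
    G →* (Lp H 2 μ ≃ₗᵢ[ℂ] Lp H 2 μ) where
  toFun g :=
    { toFun := directIntegralOp _ (h g)
      invFun := directIntegralOp _ (h g⁻¹)
      map_add' := map_add _
      map_smul' := map_smul _
      left_inv := fun ξ => by
        rw [← directIntegralRep_aux_mul]
        simp only [inv_mul_cancel]
        exact directIntegralRep_aux_one ρ h ξ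
      right_inv := fun ξ => by
        rw [← directIntegralRep_aux_mul]
        simp only [mul_inv_cancel]
        exact directIntegralRep_aux_one ρ h ξ
      norm_map' := directIntegralRep_aux_norm ρ h g }
  map_one' := by
    ext1 ξ
    exact directIntegralRep_aux_one ρ h ξ
  map_mul' g k := by
    ext1 ξ
    exact directIntegralRep_aux_mul ρ h g k ξ

lemma isClosed_directIntegral (J : X → ClosedSubmodule ℂ H) :
    IsClosed {ξ : Lp H 2 μ | ∀ᵐ x ∂μ, ξ x ∈ J x} := by
  refine isClosed_of_closure_subset fun ξ hξ => ?_
  obtain ⟨u, hu, hlim⟩ := mem_closure_iff_seq_limit.1 hξ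
  obtain ⟨φ, -, hφ⟩ := (tendstoInMeasure_of_tendsto_Lp hlim).exists_seq_tendsto_ae
  have hall : ∀ᵐ x ∂μ, ∀ k, u k x ∈ J x := ae_all_iff.2 fun k => hu k
  filter_upwards [hφ, hall] with x hx hx'
  exact (J x).isClosed.mem_of_tendsto hx (Eventually.of_forall fun i => hx' (φ i))

/-- `∫⊕ J x dμ(x)`, regarded as a closed subspace of `L²(μ; H)`: the vectors `ξ` with
`ξ x ∈ J x` for almost every `x`. -/
def directIntegral (μ : Measure X) (J : X → ClosedSubmodule ℂ H) :
    ClosedSubmodule ℂ (Lp H 2 μ) where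
  carrier := {ξ | ∀ᵐ x ∂μ, ξ x ∈ J x}
  zero_mem' := by
    filter_upwards [Lp.coeFn_zero H 2 μ] with x hx
    rw [hx]
    exact zero_mem (J x)
  add_mem' := fun {ξ η} hξ hη => by
    filter_upwards [hξ, hη, Lp.coeFn_add ξ η] with x h1 h2 h3
    rw [h3]
    exact add_mem h1 h2
  smul_mem' := fun c ξ hξ => by
    filter_upwards [hξ, Lp.coeFn_smul c ξ] with x h1 h2
    rw [h2]
    exact (J x).smul_mem c h1
  isClosed' := isClosed_directIntegral J

/-- A measurable range function (measurable field of closed subspaces of `H`): the orthogonal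
projections onto `J x` form a weakly measurable operator function. -/
def IsMeasurableRangeFunction [CompleteSpace H] (μ : Measure X) (J : X → ClosedSubmodule ℂ H) :
    Prop :=
  ∀ a b : H, AEMeasurable (fun x => ⟪a, (J x).toSubmodule.starProjection b⟫_ℂ) μ

/-- For a set `𝒜` of vectors and a choice `f Φ` of functions `X → H`, the range function
`x ↦ closed span of {f Φ x : Φ ∈ 𝒜}`. -/
def rangeFunction {ι : Type*} (𝒜 : Set ι) (f : ι → X → H) (x : X) : ClosedSubmodule ℂ H :=
  (Submodule.span ℂ ((fun Φ => f Φ x) '' 𝒜)).closure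

/-- `J` is a range function associated with the closed subspace `W` of `L²(μ; H)`: for some
countable dense set `𝒜` of vectors and some representatives `f Φ` of `P_W Φ`, `Φ ∈ 𝒜`, the space
`J x` is the closed span of the vectors `f Φ x`, `Φ ∈ 𝒜`. -/
def IsAssociatedRangeFunction [CompleteSpace H] (W : ClosedSubmodule ℂ (Lp H 2 μ))
    (J : X → ClosedSubmodule ℂ H) : Prop :=
  ∃ (𝒜 : Set (Lp H 2 μ)) (f : Lp H 2 μ → X → H), 𝒜.Countable ∧ Dense 𝒜 ∧
    (∀ Φ ∈ 𝒜, f Φ =ᵐ[μ] W.toSubmodule.starProjection Φ) ∧ J = rangeFunction 𝒜 f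

end DirectIntegral

/-! ### Crystal groups -/

section Groups

variable {n : ℕ}

/-- `I(ℝⁿ)`, the group of isometries of `ℝⁿ`, with composition as multiplication. -/
abbrev Iso (n : ℕ) : Type := EuclideanSpace ℝ (Fin n) ≃ᵃⁱ[ℝ] EuclideanSpace ℝ (Fin n)

/-- `O(n)`. -/
abbrev Orth (n : ℕ) : Type := EuclideanSpace ℝ (Fin n) ≃ₗᵢ[ℝ] EuclideanSpace ℝ (Fin n)

/-- The homomorphism `Q : I(ℝⁿ) → O(n)` that sends an isometry to its linear part. -/
def linPart (n : ℕ) : Iso n →* Orth n where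
  toFun g := g.linearIsometryEquiv
  map_one' := rfl
  map_mul' _ _ := rfl

lemma apply_eq (g : Iso n) (x : EuclideanSpace ℝ (Fin n)) : g x = linPart n g x + g 0 := by
  have h := g.map_vadd 0 x
  rw [vadd_eq_add, add_zero] at h
  exact h

/-- The orbit equivalence relation of a group of isometries. -/
def orbitRel (G : Subgroup (Iso n)) : Setoid (EuclideanSpace ℝ (Fin n)) where
  r x y := ∃ g ∈ G, g x = y
  iseqv :=
    { refl := fun x => ⟨1, G.one_mem, rfl⟩
      symm := by
        rintro x y ⟨g, hg, rfl⟩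
        exact ⟨g⁻¹, G.inv_mem hg, g.symm_apply_apply x⟩
      trans := by
        rintro x y z ⟨g, hg, rfl⟩ ⟨h, hh, rfl⟩
        exact ⟨h * g, G.mul_mem hh hg, rfl⟩ }

/-- A crystal group: a subgroup of `I(ℝⁿ)` that is discrete in the compact-open topology and whose
orbit space is compact. -/
structure IsCrystalGroup (Γ : Subgroup (Iso n)) : Prop where
  discrete : TopologicalSpace.induced
    (fun g : Γ => (⟨g.1, g.1.continuous⟩ :
      C(EuclideanSpace ℝ (Fin n), EuclideanSpace ℝ (Fin n)))) inferInstance = ⊥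
  cocompact : CompactSpace (Quotient (orbitRel Γ))

/-- A fundamental domain for a group of isometries. -/
structure IsFundDomain (G : Subgroup (Iso n)) (R : Set (EuclideanSpace ℝ (Fin n))) : Prop where
  isOpen : IsOpen R
  disjoint : ∀ g ∈ G, ∀ h ∈ G, g ≠ h → Disjoint (g '' R) (h '' R)
  cover : ⋃ g ∈ G, g '' closure R = Set.univ
  connected : IsConnected R

/-- A fundamental set for a group of isometries: it meets every orbit in exactly one point. -/
def IsFundSet (G : Subgroup (Iso n)) (S : Set (EuclideanSpace ℝ (Fin n))) : Prop :=
  ∀ x : EuclideanSpace ℝ (Fin n), ∃! s, s ∈ S ∧ ∃ g ∈ G, g x = s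

variable (Γ : Subgroup (Iso n))

/-- The point group `Π = Q(Γ)`. -/
def pointGroup : Subgroup (Orth n) := Γ.map (linPart n)

/-- The restriction `Q : Γ → Π`. -/
def toPoint : Γ →* pointGroup Γ := (linPart n).subgroupMap Γ

/-- The subgroup `T` of translations in `Γ`. -/
def translations : Subgroup Γ := ((linPart n).comp Γ.subtype).ker

/-- The lattice `𝓛` of the vectors by which `Γ` translates. -/
def lattice : AddSubgroup (EuclideanSpace ℝ (Fin n)) where
  carrier := {x | AffineIsometryEquiv.constVAdd ℝ (EuclideanSpace ℝ (Fin n)) x ∈ Γ}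
  zero_mem' := by
    change AffineIsometryEquiv.constVAdd ℝ _ 0 ∈ Γ
    rw [AffineIsometryEquiv.constVAdd_zero]
    exact Γ.one_mem
  add_mem' := fun {x y} hx hy => by
    have h := Γ.mul_mem hx hy
    have e : AffineIsometryEquiv.constVAdd ℝ (EuclideanSpace ℝ (Fin n)) (x + y) =
        AffineIsometryEquiv.constVAdd ℝ _ x * AffineIsometryEquiv.constVAdd ℝ _ y := by
      ext1 z
      simp [add_assoc]
    change AffineIsometryEquiv.constVAdd ℝ _ (x + y) ∈ Γ
    rw [e]
    exact h
  neg_mem' := fun {x} hx => by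
    have h := Γ.inv_mem hx
    have e : AffineIsometryEquiv.constVAdd ℝ (EuclideanSpace ℝ (Fin n)) (-x) =
        (AffineIsometryEquiv.constVAdd ℝ _ x)⁻¹ := by
      rw [eq_inv_iff_mul_eq_one]
      ext1 z
      simp
    change AffineIsometryEquiv.constVAdd ℝ _ (-x) ∈ Γ
    rw [e]
    exact h

/-- The dual lattice `𝓛*`. -/
def dualLattice : AddSubgroup (EuclideanSpace ℝ (Fin n)) where
  carrier := {z | ∀ x ∈ lattice Γ, ∃ k : ℤ, ⟪x, z⟫_ℝ = k}
  zero_mem' := fun x _ => ⟨0, by simp⟩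
  add_mem' := fun {y z} hy hz x hx => by
    obtain ⟨k, hk⟩ := hy x hx
    obtain ⟨l, hl⟩ := hz x hx
    exact ⟨k + l, by rw [inner_add_right, hk, hl]; push_cast; rfl⟩
  neg_mem' := fun {z} hz x hx => by
    obtain ⟨k, hk⟩ := hz x hx
    exact ⟨-k, by rw [inner_neg_right, hk]; push_cast; rfl⟩

variable {Γ}

lemma pointGroup_lattice {L : Orth n} (hL : L ∈ pointGroup Γ) {x : EuclideanSpace ℝ (Fin n)}
    (hx : x ∈ lattice Γ) : L x ∈ lattice Γ := by
  obtain ⟨g, hg, rfl⟩ := hL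
  have h := Γ.mul_mem (Γ.mul_mem hg hx) (Γ.inv_mem hg)
  change AffineIsometryEquiv.constVAdd ℝ _ _ ∈ Γ
  convert h using 1
  ext1 z
  have h1 : g (x + g.symm z) = linPart n g x + g (g.symm z) := by
    rw [apply_eq g (x + g.symm z), apply_eq g (g.symm z), map_add, add_assoc]
  simpa using h1.symm

lemma pointGroup_dualLattice {L : Orth n} (hL : L ∈ pointGroup Γ) {z : EuclideanSpace ℝ (Fin n)}
    (hz : z ∈ dualLattice Γ) : L z ∈ dualLattice Γ := fun x hx => by
  obtain ⟨k, hk⟩ := hz _ (pointGroup_lattice ((pointGroup Γ).inv_mem hL) hx)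
  refine ⟨k, ?_⟩
  rw [← hk, ← L.inner_map_map (L⁻¹ x) z]
  congr 1
  exact (L.apply_symm_apply x).symm

variable (Γ)

/-- The group `Γ*` of the isometries `x ↦ L (x + z)` with `L ∈ Π` and `z ∈ 𝓛*`. -/
def dualGroup : Subgroup (Iso n) where
  carrier := {g | ∃ L ∈ pointGroup Γ, ∃ z ∈ dualLattice Γ, ∀ x, g x = L (x + z)}
  one_mem' := ⟨1, (pointGroup Γ).one_mem, 0, (dualLattice Γ).zero_mem, fun x => by simp⟩
  mul_mem' := by
    rintro g h ⟨L, hL, z, hz, hg⟩ ⟨M, hM, w, hw, hh⟩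
    refine ⟨L * M, mul_mem hL hM, w + M⁻¹ z,
      add_mem hw (pointGroup_dualLattice (inv_mem hM) hz), fun x => ?_⟩
    have h1 : M (M⁻¹ z) = z := M.apply_symm_apply z
    simp only [AffineIsometryEquiv.coe_mul, Function.comp_apply, hg, hh,
      LinearIsometryEquiv.coe_mul, map_add, h1, add_assoc]
  inv_mem' := by
    rintro g ⟨L, hL, z, hz, hg⟩
    refine ⟨L⁻¹, inv_mem hL, -(L z), neg_mem (pointGroup_dualLattice hL hz), fun x => ?_⟩
    apply g.injective
    have h1 : ∀ y, L (L⁻¹ y) = y := fun y => L.apply_symm_apply y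
    rw [hg (L⁻¹ _), map_add, h1]
    have h2 : g (g⁻¹ x) = x := g.apply_symm_apply x
    rw [h2]
    simp

/-- A cross-section of `Q : Γ → Π`, with `γ(id) = [0, id]`. -/
structure CrossSection where
  /-- the underlying map -/
  toFun : pointGroup Γ → Γ
  toPoint_toFun : ∀ L, toPoint Γ (toFun L) = L
  map_one : toFun 1 = 1

end Groups

/-! ### The representations induced from characters of the translation subgroup -/

section Induced

variable {n : ℕ} {Γ : Subgroup (Iso n)}

/-- The character `χ_ω([y, id]) = exp(2 π i ω·y)` of the translation subgroup. -/
def chi (Γ : Subgroup (Iso n)) (ω : EuclideanSpace ℝ (Fin n)) : translations Γ →* Circle where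
  toFun t := Real.fourierChar ⟪ω, t.1.1 0⟫_ℝ
  map_one' := by simp
  map_mul' s t := by
    have hs : linPart n s.1.1 = 1 := s.2
    have h : (s * t).1.1 0 = s.1.1 0 + t.1.1 0 := by
      change s.1.1 (t.1.1 0) = _
      rw [apply_eq s.1.1 (t.1.1 0), hs, add_comm]
      rfl
    rw [h, inner_add_right, AddChar.map_add_eq_mul]

/-- The space of the functions `f` on `Γ` with `f (g t) = χ(t⁻¹) f(g)` for `t ∈ T`. -/
def indSpace (χ : translations Γ →* Circle) : Submodule ℂ (Γ → ℂ) where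
  carrier := {f | ∀ (g : Γ) (t : translations Γ), f (g * t) = (χ t⁻¹ : ℂ) * f g}
  zero_mem' := fun g t => by simp
  add_mem' := fun {f f'} h h' g t => by
    change f _ + f' _ = _ * (f g + f' g)
    rw [h, h', mul_add]
  smul_mem' := fun c f h g t => by
    change c * f _ = _ * (c * f g)
    rw [h]
    ring

/-- The induced representation: `(ind(g) f)(h) = f(g⁻¹ h)`. -/
def ind (χ : translations Γ →* Circle) (g : Γ) : indSpace χ →ₗ[ℂ] indSpace χ where
  toFun f := ⟨fun h => f.1 (g⁻¹ * h), fun h t => by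
    have := f.2 (g⁻¹ * h) t
    rw [← this, mul_assoc]⟩
  map_add' _ _ := rfl
  map_smul' _ _ := rfl

lemma toPoint_mul_translation (g : Γ) (t : translations Γ) :
    toPoint Γ (g * t) = toPoint Γ g := by
  have ht : toPoint Γ (t : Γ) = 1 := Subtype.ext t.2
  rw [map_mul, ht, mul_one]

/-- The translation `γ(Q g)⁻¹ g`. -/
def transPart (γ : CrossSection Γ) (g : Γ) : translations Γ :=
  ⟨(γ.toFun (toPoint Γ g))⁻¹ * g, by
    have h : toPoint Γ ((γ.toFun (toPoint Γ g))⁻¹ * g) = 1 := by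
      rw [map_mul, map_inv, γ.toPoint_toFun, inv_mul_cancel]
    exact congrArg Subtype.val h⟩

lemma transPart_spec (γ : CrossSection Γ) (g : Γ) :
    γ.toFun (toPoint Γ g) * (transPart γ g : Γ) = g := by
  simp [transPart]

/-- The map `(W f)(L) = f(γ(L))`, with inverse `(W⁻¹ ζ)(γ(L) t) = χ(t⁻¹) ζ(L)`. -/
def indEquiv (χ : translations Γ →* Circle) (γ : CrossSection Γ) :
    indSpace χ ≃ₗ[ℂ] (pointGroup Γ → ℂ) where
  toFun f L := f.1 (γ.toFun L)
  map_add' _ _ := rfl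
  map_smul' _ _ := rfl
  invFun ζ := ⟨fun g => (χ (transPart γ g)⁻¹ : ℂ) * ζ (toPoint Γ g), fun g t => by
    have h : transPart γ (g * t) = transPart γ g * t := by
      apply Subtype.ext
      simp [transPart, toPoint_mul_translation, mul_assoc]
    change (χ (transPart γ (g * t))⁻¹ : ℂ) * ζ (toPoint Γ (g * t)) =
      (χ t⁻¹ : ℂ) * ((χ (transPart γ g)⁻¹ : ℂ) * ζ (toPoint Γ g))
    rw [h, toPoint_mul_translation, mul_inv_rev, map_mul, Circle.coe_mul, mul_assoc]⟩
  left_inv f := by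
    apply Subtype.ext
    funext g
    change (χ (transPart γ g)⁻¹ : ℂ) * f.1 (γ.toFun (toPoint Γ g)) = f.1 g
    rw [← f.2, transPart_spec]
  right_inv ζ := by
    funext L
    have h : transPart γ (γ.toFun L) = 1 := by
      apply Subtype.ext
      simp [transPart, γ.toPoint_toFun]
    change (χ (transPart γ (γ.toFun L))⁻¹ : ℂ) * ζ (toPoint Γ (γ.toFun L)) = ζ L
    rw [h, γ.toPoint_toFun]
    simp

/-- The operator `W ind(g) W⁻¹` on functions on the point group. -/
def indOp (χ : translations Γ →* Circle) (γ : CrossSection Γ) (g : Γ) :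
    (pointGroup Γ → ℂ) →ₗ[ℂ] (pointGroup Γ → ℂ) :=
  (indEquiv χ γ).toLinearMap ∘ₗ ind χ g ∘ₗ (indEquiv χ γ).symm.toLinearMap

lemma indOp_one (χ : translations Γ →* Circle) (γ : CrossSection Γ) (ζ : pointGroup Γ → ℂ) :
    indOp χ γ 1 ζ = ζ := by
  have h : ind χ (1 : Γ) = LinearMap.id := by
    ext f k
    simp [ind]
  simp [indOp, h]

lemma indOp_mul (χ : translations Γ →* Circle) (γ : CrossSection Γ) (g k : Γ)
    (ζ : pointGroup Γ → ℂ) : indOp χ γ (g * k) ζ = indOp χ γ g (indOp χ γ k ζ) := by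
  have h : ind χ (g * k) = ind χ g ∘ₗ ind χ k := by
    ext f l
    simp [ind, mul_assoc]
  simp [indOp, h]

lemma indOp_apply (χ : translations Γ →* Circle) (γ : CrossSection Γ) (g : Γ)
    (ζ : pointGroup Γ → ℂ) (M : pointGroup Γ) :
    indOp χ γ g ζ M = (χ (transPart γ (g⁻¹ * γ.toFun M))⁻¹ : ℂ) * ζ ((toPoint Γ g)⁻¹ * M) := by
  change (χ (transPart γ (g⁻¹ * γ.toFun M))⁻¹ : ℂ) * ζ (toPoint Γ (g⁻¹ * γ.toFun M)) = _
  rw [map_mul (toPoint Γ), map_inv (toPoint Γ), γ.toPoint_toFun]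

lemma norm_indOp_apply (χ : translations Γ →* Circle) (γ : CrossSection Γ) (g : Γ)
    (ζ : pointGroup Γ → ℂ) (M : pointGroup Γ) :
    ‖indOp χ γ g ζ M‖ = ‖ζ ((toPoint Γ g)⁻¹ * M)‖ := by
  rw [indOp_apply, norm_mul, Circle.norm_coe, one_mul]

/-- `l²(Π)`. -/
abbrev l2Point (Γ : Subgroup (Iso n)) : Type := lp (fun _ : pointGroup Γ => ℂ) 2

/-- `l²(𝓛*)`. -/
abbrev l2Dual (Γ : Subgroup (Iso n)) : Type := lp (fun _ : dualLattice Γ => ℂ) 2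

lemma memℓp_indOp (χ : translations Γ →* Circle) (γ : CrossSection Γ) (g : Γ)
    (ζ : l2Point Γ) : Memℓp (indOp χ γ g ζ) 2 := by
  have h2 : 0 < (2 : ℝ≥0∞).toReal := by norm_num
  have h := (lp.memℓp ζ).summable h2
  refine memℓp_gen ?_
  simp only [norm_indOp_apply]
  exact h.comp_injective (mul_right_injective (toPoint Γ g)⁻¹)

/-- The representation `U^χ` of `Γ` on `l²(Π)`: `U^χ(g) = W ind(g) W⁻¹`. -/
def indRep (χ : translations Γ →* Circle) (γ : CrossSection Γ) :
    Γ →* (l2Point Γ ≃ₗᵢ[ℂ] l2Point Γ) where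
  toFun g :=
    { toFun := fun ζ => ⟨indOp χ γ g ζ, memℓp_indOp χ γ g ζ⟩
      invFun := fun ζ => ⟨indOp χ γ g⁻¹ ζ, memℓp_indOp χ γ g⁻¹ ζ⟩
      map_add' := fun ζ η => Subtype.ext ((indOp χ γ g).map_add ζ η)
      map_smul' := fun c ζ => Subtype.ext ((indOp χ γ g).map_smul c ζ)
      left_inv := fun ζ => Subtype.ext (by
        change indOp χ γ g⁻¹ (indOp χ γ g ζ) = ζ
        rw [← indOp_mul, inv_mul_cancel, indOp_one])
      right_inv := fun ζ => Subtype.ext (by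
        change indOp χ γ g (indOp χ γ g⁻¹ ζ) = ζ
        rw [← indOp_mul, mul_inv_cancel, indOp_one])
      norm_map' := fun ζ => by
        have h2 : 0 < (2 : ℝ≥0∞).toReal := by norm_num
        rw [lp.norm_eq_tsum_rpow h2, lp.norm_eq_tsum_rpow h2]
        congr 1
        have h := (Equiv.mulLeft (toPoint Γ g)⁻¹).tsum_eq
          (fun M => ‖(ζ : pointGroup Γ → ℂ) M‖ ^ (2 : ℝ≥0∞).toReal)
        rw [← h]
        refine tsum_congr fun M => ?_
        change ‖indOp χ γ g ζ M‖ ^ _ = _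
        rw [norm_indOp_apply]
        rfl }
  map_one' := by
    ext1 ζ
    exact Subtype.ext (indOp_one χ γ ζ)
  map_mul' g k := by
    ext1 ζ
    exact Subtype.ext (indOp_mul χ γ g k ζ)

/-- `U^χ(g) ζ (M) = χ(γ(M)⁻¹ g γ(L⁻¹ M)) ζ(L⁻¹ M)` for `L = Q g`. -/
lemma indRep_apply (χ : translations Γ →* Circle) (γ : CrossSection Γ) (g : Γ) (ζ : l2Point Γ)
    (M : pointGroup Γ) (t : translations Γ)
    (ht : (t : Γ) = (γ.toFun M)⁻¹ * g * γ.toFun ((toPoint Γ g)⁻¹ * M)) :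
    indRep χ γ g ζ M = (χ t : ℂ) * ζ ((toPoint Γ g)⁻¹ * M) := by
  change indOp χ γ g ζ M = _
  rw [indOp_apply]
  have h : (transPart γ (g⁻¹ * γ.toFun M))⁻¹ = t := by
    apply Subtype.ext
    rw [ht]
    simp [transPart, γ.toPoint_toFun, mul_assoc]
  rw [h]

/-- `ℋ = l²(Π) ⊗ l²(𝓛*)`. -/
abbrev fiber (Γ : Subgroup (Iso n)) : Type := HilbertTensor (l2Point Γ) (l2Dual Γ)

/-- The representation `U^{χ_ω} ⊗ I` of `Γ` on `l²(Π) ⊗ l²(𝓛*)`. -/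
def fiberRep (γ : CrossSection Γ) (ω : EuclideanSpace ℝ (Fin n)) :
    Γ →* (fiber Γ ≃ₗᵢ[ℂ] fiber Γ) :=
  (ampl (l2Dual Γ)).comp (indRep (chi Γ ω) γ)

lemma continuous_of_isometries {X V : Type*} [TopologicalSpace X] [NormedAddCommGroup V]
    [InnerProductSpace ℂ V] (T : X → V ≃ₗᵢ[ℂ] V) (D : Set V)
    (hD : (Submodule.span ℂ D).topologicalClosure = ⊤)
    (h : ∀ v ∈ D, Continuous fun x => T x v) (v : V) : Continuous fun x => T x v := by
  let S : Submodule ℂ V :=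
    { carrier := {v | Continuous fun x => T x v}
      zero_mem' := by simpa using continuous_const
      add_mem' := fun {v w} hv hw => by
        simpa [Pi.add_def] using Continuous.add hv hw
      smul_mem' := fun c v hv => by
        simpa [Pi.smul_def] using Continuous.const_smul hv c }
  have hS : IsClosed (S : Set V) := by
    refine isClosed_of_closure_subset fun v hv => ?_
    obtain ⟨u, hu, hlim⟩ := mem_closure_iff_seq_limit.1 hv
    have hunif : TendstoUniformly (fun k x => T x (u k)) (fun x => T x v) atTop := by
      rw [Metric.tendstoUniformly_iff]
      intro ε hε
      filter_upwards [Metric.tendsto_nhds.1 hlim ε hε] with k hk x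
      rw [(T x).dist_map, dist_comm]
      exact hk
    exact hunif.continuous (Frequently.of_forall fun k => hu k)
  have hle : (Submodule.span ℂ D).topologicalClosure ≤ S :=
    Submodule.topologicalClosure_minimal _ (Submodule.span_le.2 fun v hv => h v hv) hS
  rw [hD] at hle
  exact hle trivial

lemma isBoundedMeasurableField_of_continuous {V : Type*} [NormedAddCommGroup V]
    [InnerProductSpace ℂ V] (μ : Measure (EuclideanSpace ℝ (Fin n)))
    (T : EuclideanSpace ℝ (Fin n) → V ≃ₗᵢ[ℂ] V) (hT : ∀ v, Continuous fun ω => T ω v) :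
    IsBoundedMeasurableField μ (fun ω => (T ω : V →L[ℂ] V)) := by
  refine ⟨fun ξ hξ => ?_, 1, Eventually.of_forall fun ω => ?_⟩
  · have hc : Continuous fun p : EuclideanSpace ℝ (Fin n) × V => T p.1 p.2 := by
      rw [continuous_iff_continuousAt]
      rintro ⟨ω, v⟩
      have h1 : Tendsto (fun p : EuclideanSpace ℝ (Fin n) × V => T p.1 v)
          (𝓝 (ω, v)) (𝓝 (T ω v)) :=
        ((hT v).comp continuous_fst).tendsto (ω, v)
      have h2 : Tendsto (fun p : EuclideanSpace ℝ (Fin n) × V => T p.1 p.2 - T p.1 v)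
          (𝓝 (ω, v)) (𝓝 0) := by
        rw [tendsto_zero_iff_norm_tendsto_zero]
        have h3 : ∀ p : EuclideanSpace ℝ (Fin n) × V,
            ‖T p.1 p.2 - T p.1 v‖ = ‖p.2 - v‖ := fun p => by
          rw [← map_sub, LinearIsometryEquiv.norm_map]
        simp only [h3]
        have h4 : Continuous fun p : EuclideanSpace ℝ (Fin n) × V => ‖p.2 - v‖ := by
          fun_prop
        simpa using h4.tendsto (ω, v)
      simpa [ContinuousAt] using h2.add h1
    exact hc.comp_aestronglyMeasurable (aestronglyMeasurable_id.prodMk hξ)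
  · exact (T ω).toLinearIsometry.norm_toContinuousLinearMap_le

lemma continuous_indRep (γ : CrossSection Γ) (g : Γ) (ζ : l2Point Γ) :
    Continuous fun ω => indRep (chi Γ ω) γ g ζ := by
  classical
  refine continuous_of_isometries (fun ω => indRep (chi Γ ω) γ g)
    (Set.range fun p : pointGroup Γ × ℂ => lp.single 2 p.1 p.2) ?_ ?_ ζ
  · rw [Submodule.eq_top_iff']
    intro ζ
    have hs := lp.hasSum_single (by norm_num) ζ
    refine mem_closure_of_tendsto hs (Eventually.of_forall fun s => ?_)
    exact Submodule.sum_mem _ fun M _ => Submodule.subset_span ⟨(M, ζ M), rfl⟩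
  · rintro _ ⟨⟨M, c⟩, rfl⟩
    let t : translations Γ := (transPart γ (g⁻¹ * γ.toFun (toPoint Γ g * M)))⁻¹
    have key : ∀ ω, indRep (chi Γ ω) γ g (lp.single 2 M c) =
        (chi Γ ω t : ℂ) • (lp.single 2 (toPoint Γ g * M) c : l2Point Γ) := by
      intro ω
      apply Subtype.ext
      funext N
      change indOp (chi Γ ω) γ g _ N = (chi Γ ω t : ℂ) * _
      rw [indOp_apply]
      by_cases hN : N = toPoint Γ g * M
      · subst hN
        simp [t]
      · have h1 : (toPoint Γ g)⁻¹ * N ≠ M := fun h => hN (by rw [← h, mul_inv_cancel_left])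
        simp [lp.single_apply, hN, h1]
    simp only [key]
    have hc : Continuous fun ω => (chi Γ ω t : ℂ) := by
      change Continuous fun ω => ((Real.fourierChar ⟪ω, t.1.1 0⟫_ℝ : Circle) : ℂ)
      exact continuous_subtype_val.comp (Real.continuous_fourierChar.comp (by fun_prop))
    exact hc.smul continuous_const

lemma continuous_fiberRep (γ : CrossSection Γ) (g : Γ) (v : fiber Γ) :
    Continuous fun ω => fiberRep γ ω g v := by
  refine continuous_of_isometries (fun ω => fiberRep γ ω g)
    {v | ∃ a b, v = elemTensor a b} ?_ ?_ v
  · rw [Submodule.eq_top_iff']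
    intro v
    induction v using UniformSpace.Completion.induction_on with
    | hp => exact Submodule.isClosed_topologicalClosure _
    | ih x =>
      refine Submodule.le_topologicalClosure _ ?_
      induction x using TensorProduct.induction_on with
      | zero => exact zero_mem _
      | tmul a b => exact Submodule.subset_span ⟨a, b, rfl⟩
      | add x y hx hy =>
        rw [UniformSpace.Completion.coe_add]
        exact add_mem hx hy
  · rintro _ ⟨a, b, rfl⟩
    have h : ∀ ω, fiberRep γ ω g (elemTensor a b) = elemTensor (indRep (chi Γ ω) γ g a) b :=
      fun ω => ampl_elemTensor _ a b
    simp only [h]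
    have h1 : Continuous fun a : l2Point Γ => elemTensor a b := by
      have h2 : Continuous fun a : l2Point Γ => a ⊗ₜ[ℂ] b :=
        TensorProduct.continuous_tmul.comp (continuous_id.prodMk continuous_const)
      exact (UniformSpace.Completion.continuous_coe _).comp h2
    exact h1.comp (continuous_indRep γ g a)

/-- The representations `U^{χ_ω} ⊗ I` form a measurable field. -/
lemma isMeasurableRepField_fiberRep (γ : CrossSection Γ)
    (μ : Measure (EuclideanSpace ℝ (Fin n))) : IsMeasurableRepField μ (fiberRep γ) := fun g =>
  isBoundedMeasurableField_of_continuous μ (fun ω => fiberRep γ ω g) (continuous_fiberRep γ g)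

/-- `L²(Ω; l²(Π) ⊗ l²(𝓛*))` with respect to Lebesgue measure. -/
abbrev L2 (Γ : Subgroup (Iso n)) (Ω : Set (EuclideanSpace ℝ (Fin n))) : Type :=
  Lp (fiber Γ) 2 (volume.restrict Ω)

/-- The representation `τ = ∫⊕_Ω U^{χ_ω} ⊗ I dω` of `Γ` on `L²(Ω; l²(Π) ⊗ l²(𝓛*))`. -/
def tau (γ : CrossSection Γ) (Ω : Set (EuclideanSpace ℝ (Fin n))) :
    Γ →* (L2 Γ Ω ≃ₗᵢ[ℂ] L2 Γ Ω) :=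
  directIntegralRep (fiberRep γ) (isMeasurableRepField_fiberRep γ (volume.restrict Ω))

end Induced

end Crystal

end

/-! In `U^{χ_ω}` the translation by `y ∈ 𝓛` is diagonal: it multiplies the coordinate at `M ∈ Π` by
`exp(2πi Mω·y)`. The points `Mω` and `M'ω'` define the same character of `𝓛` only if they differ by
an element of `𝓛*`, and then an element of `Γ*` with linear part `M'⁻¹M` carries `ω` to `ω'`. For
`ω, ω' ∈ R` the disjointness of the sets `gR` forces `ω = ω'` and `M = M'`
(`eq_of_forall_fourierChar_eq`). So the lattice characters separate the points of `R × Π`, and an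
integrable function there whose integrals against all of them vanish is zero almost everywhere
(`ae_eq_zero_of_forall_integral_fourierChar`).

Irreducibility is this statement at a single `ω ∈ R`: if `p ∈ K` and `q ⟂ K` with `K` invariant, the
summable function `M ↦ conj(q M) p M` has vanishing integrals against the characters, hence is zero.
Splitting the basis vector at `id` along `K` and its complement therefore leaves it in one of the
two, and the operators of `γ(M)` move it to every other basis vector.

For an invariant `W`, take `ξ ∈ W` and `η ⟂ W`. The same argument on `R × Π` shows that the
coordinates of `η(ω)` and `ξ(ω)` in `l²(𝓛*)` are orthogonal for almost every `ω` and every `M`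
(`ae_inner_tensorCoord_eq_zero_of_isInvariant`). Summed over `M`, this gives pointwise orthogonality
of `W` and its complement, which makes `P_W` act fibrewise as the projection onto `J_W(ω)`. Taken
for each `M` separately, it makes `J_W(ω)` stable under the coordinate projections. Stability under
`γ(M)` and `γ(M)⁻¹` then puts the same subspace in every coordinate, so `J_W(ω) = l²(Π) ⊗ F_ω`
(`eq_tensorSubspace`). Conversely, such fibres are invariant under every operator `u ⊗ I`. -/

namespace Crystal

/-! ### Uniqueness of integrable functions from integrals against separating families. -/

section FourierUniqueness

open scoped BoundedContinuousFunction
open BoundedContinuousFunction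

variable {E : Type*} [TopologicalSpace E] [PolishSpace E] [MeasurableSpace E] [BorelSpace E]

/-- A real integrable function is determined by its integrals against a separating star subalgebra
of bounded continuous functions. -/
lemma ae_eq_zero_of_starSubalgebra_real (ν : Measure E) (A : StarSubalgebra ℂ (E →ᵇ ℂ))
    (hA : (A.map (toContinuousMapStarₐ ℂ)).SeparatesPoints) {u : E → ℝ} (hu : Integrable u ν)
    (h : ∀ φ ∈ A, ∫ x, φ x * (u x : ℂ) ∂ν = 0) : u =ᵐ[ν] 0 := by
  -- The positive and negative parts of `u` are densities of two finite measures. These agree on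
  -- `A`, hence coincide, so the two parts are equal almost everywhere; having disjoint supports,
  -- both vanish.
  have : IsFiniteMeasure (ν.withDensity fun x => ENNReal.ofReal (u x)) :=
    isFiniteMeasure_withDensity_ofReal hu.2
  have : IsFiniteMeasure (ν.withDensity fun x => ENNReal.ofReal (-u x)) :=
    isFiniteMeasure_withDensity_ofReal hu.neg.2
  have hm : AEMeasurable (fun x => ENNReal.ofReal (u x)) ν := hu.aemeasurable.ennreal_ofReal
  have hm' : AEMeasurable (fun x => ENNReal.ofReal (-u x)) ν :=
    hu.aemeasurable.neg.ennreal_ofReal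
  have hbound : ∀ (φ : E →ᵇ ℂ) (v : E → ℝ), Integrable v ν →
      Integrable (fun x => (ENNReal.ofReal (v x)).toReal • φ x) ν := fun φ v hv => by
    have h1 : Integrable (fun x => (ENNReal.ofReal (v x)).toReal) ν := by
      simpa [ENNReal.toReal_ofReal'] using hv.pos_part
    exact h1.smul_bdd ‖φ‖ φ.continuous.aestronglyMeasurable
      (Eventually.of_forall fun x => φ.norm_coe_le_norm x)
  have heq : ν.withDensity (fun x => ENNReal.ofReal (u x)) =
      ν.withDensity (fun x => ENNReal.ofReal (-u x)) := by
    refine ext_of_forall_mem_subalgebra_integral_eq_of_polish hA fun φ hφ => ?_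
    rw [integral_withDensity_eq_integral_toReal_smul₀ hm (by simp),
      integral_withDensity_eq_integral_toReal_smul₀ hm' (by simp), ← sub_eq_zero,
      ← integral_sub (hbound φ u hu) (hbound φ (fun x => -u x) hu.neg), ← h φ hφ]
    refine integral_congr_ae (Eventually.of_forall fun x => ?_)
    simp only [ENNReal.toReal_ofReal', Complex.real_smul, mul_comm]
    rcases le_total 0 (u x) with h0 | h0 <;> simp [h0]
  have hfin : ∫⁻ x, ENNReal.ofReal (u x) ∂ν ≠ ∞ := hu.lintegral_lt_top.ne
  filter_upwards [(withDensity_eq_iff hm hm' hfin).1 heq] with x hx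
  rcases le_total 0 (u x) with h0 | h0
  · rw [ENNReal.ofReal_of_nonpos (neg_nonpos.2 h0), ENNReal.ofReal_eq_zero] at hx
    exact le_antisymm hx h0
  · rw [ENNReal.ofReal_of_nonpos h0, eq_comm, ENNReal.ofReal_eq_zero] at hx
    exact le_antisymm h0 (by simpa using hx)

/-- An integrable function is zero almost everywhere if its integrals against a separating
self-adjoint multiplicative family of bounded continuous functions vanish. -/
lemma ae_eq_zero_of_forall_integral_submonoid (ν : Measure E) (S : Submonoid (E →ᵇ ℂ))
    (hstar : ∀ φ ∈ S, star φ ∈ S) (hsep : ∀ x y, (∀ φ ∈ S, φ x = φ y) → x = y)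
    {f : E → ℂ} (hf : Integrable f ν) (h : ∀ φ ∈ S, ∫ x, φ x * f x ∂ν = 0) : f =ᵐ[ν] 0 := by
  let A : StarSubalgebra ℂ (E →ᵇ ℂ) := StarAlgebra.adjoin ℂ (S : Set (E →ᵇ ℂ))
  have hA : (A.map (toContinuousMapStarₐ ℂ)).SeparatesPoints := by
    intro x y hxy
    by_contra hcon
    push Not at hcon
    refine hxy (hsep x y fun φ hφ => ?_)
    exact hcon _ ⟨toContinuousMapStarₐ ℂ φ,
      ⟨φ, StarAlgebra.subset_adjoin ℂ _ hφ, rfl⟩, rfl⟩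
  have hint : ∀ φ : E →ᵇ ℂ, Integrable (fun x => φ x * f x) ν := fun φ =>
    hf.bdd_mul (c := ‖φ‖) φ.continuous.aestronglyMeasurable
      (Eventually.of_forall fun x => φ.norm_coe_le_norm x)
  have hzero : ∀ φ ∈ A, ∫ x, φ x * f x ∂ν = 0 := by
    intro φ hφ
    -- Since `S` is closed under multiplication and `star`, the star algebra it generates is just
    -- its linear span.
    have hss : (S : Set (E →ᵇ ℂ)) ∪ star (S : Set (E →ᵇ ℂ)) = S := by
      refine Set.union_eq_left.2 fun φ hφ => ?_
      have := hstar _ (Set.mem_star.1 hφ)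
      rwa [star_star] at this
    have h1 : φ ∈ Submodule.span ℂ (S : Set (E →ᵇ ℂ)) := by
      have h2 : φ ∈ Algebra.adjoin ℂ ((S : Set (E →ᵇ ℂ)) ∪ star (S : Set (E →ᵇ ℂ))) := hφ
      rw [hss, ← Subalgebra.mem_toSubmodule, Algebra.adjoin_eq_span, Submonoid.closure_eq] at h2
      exact h2
    clear hφ
    induction h1 using Submodule.span_induction with
    | mem φ hφ => exact h φ hφ
    | zero => simp
    | add φ ψ _ _ h1 h2 =>
      simp only [BoundedContinuousFunction.coe_add, Pi.add_apply, add_mul]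
      rw [integral_add (hint φ) (hint ψ), h1, h2, add_zero]
    | smul c φ _ h1 =>
      simp only [BoundedContinuousFunction.coe_smul, smul_eq_mul, mul_assoc]
      rw [integral_const_mul, h1, mul_zero]
  -- Conjugating the identity for `star φ` handles the conjugate of `f`; real and imaginary parts
  -- then fall under the real case.
  have hzero' : ∀ φ ∈ A, ∫ x, φ x * (starRingEnd ℂ) (f x) ∂ν = 0 := by
    intro φ hφ
    have h1 := congrArg (starRingEnd ℂ) (hzero _ (star_mem hφ))
    rw [map_zero, ← integral_conj] at h1
    rw [← h1]
    simp
  have hint' : ∀ φ : E →ᵇ ℂ, Integrable (fun x => φ x * (starRingEnd ℂ) (f x)) ν := fun φ => by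
    have h1 : Integrable (fun x => (starRingEnd ℂ) (f x)) ν :=
      Complex.conjCLE.toContinuousLinearMap.integrable_comp hf
    exact h1.bdd_mul (c := ‖φ‖) φ.continuous.aestronglyMeasurable
      (Eventually.of_forall fun x => φ.norm_coe_le_norm x)
  have hre : (fun x => (f x).re) =ᵐ[ν] 0 := by
    refine ae_eq_zero_of_starSubalgebra_real ν A hA hf.re fun φ hφ => ?_
    have h1 : ∀ x, φ x * ((f x).re : ℂ) =
        (1 / 2) * (φ x * f x + φ x * (starRingEnd ℂ) (f x)) := fun x => by
      rw [Complex.re_eq_add_conj]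
      ring
    simp only [h1]
    rw [integral_const_mul, integral_add (hint φ) (hint' φ), hzero φ hφ, hzero' φ hφ]
    simp
  have him : (fun x => (f x).im) =ᵐ[ν] 0 := by
    refine ae_eq_zero_of_starSubalgebra_real ν A hA hf.im fun φ hφ => ?_
    have h1 : ∀ x, φ x * ((f x).im : ℂ) =
        (1 / (2 * Complex.I)) * (φ x * f x - φ x * (starRingEnd ℂ) (f x)) := fun x => by
      rw [Complex.im_eq_sub_conj]
      ring
    simp only [h1]
    rw [integral_const_mul, integral_sub (hint φ) (hint' φ), hzero φ hφ, hzero' φ hφ]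
    simp
  filter_upwards [hre, him] with x h1 h2
  exact Complex.ext h1 h2

end FourierUniqueness

/-! ### Lattice translations, the dual group and the fundamental domain. -/

section Geometry

variable {n : ℕ} {Γ : Subgroup (Iso n)}

/-- The translation by a lattice vector, as an element of the translation subgroup. -/
noncomputable def latticeTranslation {y : EuclideanSpace ℝ (Fin n)} (hy : y ∈ lattice Γ) : translations Γ :=
  ⟨⟨AffineIsometryEquiv.constVAdd ℝ _ y, hy⟩, by
    change linPart n (AffineIsometryEquiv.constVAdd ℝ _ y) = 1
    ext1 x
    have h := apply_eq (AffineIsometryEquiv.constVAdd ℝ (EuclideanSpace ℝ (Fin n)) y) x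
    simpa [add_comm] using h.symm⟩

lemma toPoint_latticeTranslation {y : EuclideanSpace ℝ (Fin n)} (hy : y ∈ lattice Γ) :
    toPoint Γ (latticeTranslation hy : Γ) = 1 :=
  Subtype.ext (latticeTranslation hy).2

lemma linPart_crossSection (γ : CrossSection Γ) (M : pointGroup Γ) :
    linPart n (γ.toFun M : Iso n) = M :=
  congrArg Subtype.val (γ.toPoint_toFun M)

/-- Lattice translations act diagonally in the induced representation. -/
lemma indRep_latticeTranslation (γ : CrossSection Γ) (ω : EuclideanSpace ℝ (Fin n))
    {y : EuclideanSpace ℝ (Fin n)} (hy : y ∈ lattice Γ) (ζ : l2Point Γ) (M : pointGroup Γ) :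
    indRep (chi Γ ω) γ (latticeTranslation hy : Γ) ζ M =
      (Real.fourierChar ⟪(M : Orth n) ω, y⟫_ℝ : ℂ) * ζ M := by
  -- This conjugate is the translation by `M⁻¹ y`, and `ω · M⁻¹y = Mω · y`.
  have hmem : (γ.toFun M)⁻¹ * (latticeTranslation hy : Γ) * γ.toFun M ∈ translations Γ := by
    have h := (MonoidHom.normal_ker ((linPart n).comp Γ.subtype)).conj_mem _
      (latticeTranslation hy).2 (γ.toFun M)⁻¹
    rwa [inv_inv] at h
  rw [indRep_apply (chi Γ ω) γ _ ζ M ⟨_, hmem⟩ (by simp [toPoint_latticeTranslation]),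
    toPoint_latticeTranslation, inv_one, one_mul]
  congr 2
  change Real.fourierChar ⟪ω, (γ.toFun M : Iso n).symm (y + (γ.toFun M : Iso n) 0)⟫_ℝ = _
  congr 1
  rw [← (M : Orth n).inner_map_map ω]
  congr 1
  have h := apply_eq (γ.toFun M : Iso n) ((γ.toFun M : Iso n).symm (y + (γ.toFun M : Iso n) 0))
  rw [AffineIsometryEquiv.apply_symm_apply, linPart_crossSection, add_left_inj] at h
  exact h.symm

/-- The value of the cross-section at `M` maps the first basis vector to the one indexed by `M`. -/
lemma indRep_crossSection_single [DecidableEq (pointGroup Γ)] (χ : translations Γ →* Circle)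
    (γ : CrossSection Γ) (M : pointGroup Γ) (c : ℂ) :
    indRep χ γ (γ.toFun M) (lp.single 2 1 c) = lp.single 2 M c := by
  apply Subtype.ext
  funext N
  change indRep χ γ (γ.toFun M) (lp.single 2 1 c) N = _
  by_cases hN : N = M
  · subst hN
    rw [indRep_apply χ γ _ _ N 1 (by simp [γ.toPoint_toFun, γ.map_one])]
    simp [γ.toPoint_toFun]
  · change indOp χ γ _ _ N = _
    have h1 : M⁻¹ * N ≠ 1 := fun h => hN (inv_mul_eq_one.1 h).symm
    rw [indOp_apply, γ.toPoint_toFun]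
    simp [lp.single_apply, hN, h1]

lemma indRep_crossSection_inv_single [DecidableEq (pointGroup Γ)] (χ : translations Γ →* Circle)
    (γ : CrossSection Γ) (M : pointGroup Γ) (c : ℂ) :
    indRep χ γ (γ.toFun M)⁻¹ (lp.single 2 M c) = lp.single 2 1 c := by
  rw [← indRep_crossSection_single χ γ M c, map_inv]
  exact (indRep χ γ (γ.toFun M)).symm_apply_apply _

/-- The isometry `x ↦ L (x + z)`. -/
noncomputable def isoOf (z : EuclideanSpace ℝ (Fin n)) (L : Orth n) : Iso n :=
  (AffineIsometryEquiv.constVAdd ℝ _ z).trans L.toAffineIsometryEquiv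

lemma isoOf_apply (z x : EuclideanSpace ℝ (Fin n)) (L : Orth n) : isoOf z L x = L (x + z) := by
  simp [isoOf, add_comm]

lemma isoOf_mem_dualGroup {z : EuclideanSpace ℝ (Fin n)} {L : Orth n} (hz : z ∈ dualLattice Γ)
    (hL : L ∈ pointGroup Γ) : isoOf z L ∈ dualGroup Γ :=
  ⟨L, hL, z, hz, fun x => isoOf_apply z x L⟩

lemma isoOf_injective : Function.Injective fun p : EuclideanSpace ℝ (Fin n) × Orth n =>
    isoOf p.1 p.2 := by
  rintro ⟨z, L⟩ ⟨w, M⟩ h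
  have hx : ∀ x, L (x + z) = M (x + w) := fun x => by
    rw [← isoOf_apply, ← isoOf_apply]
    exact DFunLike.congr_fun h x
  have hLM : L = M := by
    ext1 x
    have h1 := hx x
    have h0 := hx 0
    rw [zero_add, zero_add] at h0
    rwa [map_add, map_add, h0, add_left_inj] at h1
  subst hLM
  have h0 := L.injective (hx 0)
  simpa using h0

lemma isoOf_zero_one : isoOf (0 : EuclideanSpace ℝ (Fin n)) 1 = 1 := by
  ext1 x
  simp [isoOf_apply]

variable {R Ω : Set (EuclideanSpace ℝ (Fin n))}

/-- The sets `gR` are disjoint, nonempty and open in a separable space. The point group and the dual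
lattice embed in `Γ*`, so they are countable as well. -/
lemma countable_dualGroup (hR : IsFundDomain (dualGroup Γ) R) : Countable (dualGroup Γ) := by
  have h : (Set.univ : Set (dualGroup Γ)).PairwiseDisjoint fun g => (g : Iso n) '' R := by
    intro g _ k _ hgk
    exact hR.disjoint g g.2 k k.2 fun h => hgk (Subtype.ext h)
  rw [← Set.countable_univ_iff]
  refine h.countable_of_isOpen (fun g _ => ?_) fun g _ => hR.connected.nonempty.image _
  exact (g : Iso n).toHomeomorph.isOpenMap R hR.isOpen

lemma countable_pointGroup (hR : IsFundDomain (dualGroup Γ) R) : Countable (pointGroup Γ) := by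
  have := countable_dualGroup hR
  refine Function.Injective.countable (β := dualGroup Γ)
    (f := fun M => ⟨isoOf 0 M, isoOf_mem_dualGroup (zero_mem _) M.2⟩) fun M N h => ?_
  exact Subtype.ext (congrArg Prod.snd (@isoOf_injective n (0, M) (0, N)
    (congrArg Subtype.val h)))

lemma countable_dualLattice (hR : IsFundDomain (dualGroup Γ) R) : Countable (dualLattice Γ) := by
  have := countable_dualGroup hR
  refine Function.Injective.countable (β := dualGroup Γ)
    (f := fun z => ⟨isoOf z 1, isoOf_mem_dualGroup z.2 (one_mem _)⟩) fun z w h => ?_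
  exact Subtype.ext (congrArg Prod.fst (@isoOf_injective n ((z : EuclideanSpace ℝ (Fin n)), 1)
    ((w : EuclideanSpace ℝ (Fin n)), 1) (congrArg Subtype.val h)))

/-- The lattice characters at the points `M ω` separate the pairs `(ω, M)`, `ω ∈ R`, `M ∈ Π`. -/
lemma eq_of_forall_fourierChar_eq (hR : IsFundDomain (dualGroup Γ) R)
    {ω ω' : EuclideanSpace ℝ (Fin n)} (hω : ω ∈ R) (hω' : ω' ∈ R) {M M' : pointGroup Γ}
    (h : ∀ y ∈ lattice Γ, Real.fourierChar ⟪(M : Orth n) ω, y⟫_ℝ =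
      Real.fourierChar ⟪(M' : Orth n) ω', y⟫_ℝ) : ω = ω' ∧ M = M' := by
  -- Equality of the two characters at `y` says that the difference pairs with `y` to an integer.
  have hz : (M : Orth n) ω - (M' : Orth n) ω' ∈ dualLattice Γ := by
    intro y hy
    have h1 := h y hy
    rw [← mul_inv_eq_one, ← AddChar.map_neg_eq_inv, ← AddChar.map_add_eq_mul, ← sub_eq_add_neg,
      ← inner_sub_left, real_inner_comm] at h1
    rw [Real.fourierChar_apply', Circle.exp_eq_one] at h1
    obtain ⟨k, hk⟩ := h1
    refine ⟨k, ?_⟩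
    have hpi := Real.two_pi_pos.ne'
    field_simp at hk
    linarith
  have hM' : ∀ x, (M'⁻¹ : pointGroup Γ).1 ((M' : Orth n) x) = x := fun x =>
    (M' : Orth n).symm_apply_apply x
  have hM : ∀ x, (M : Orth n) ((M⁻¹ : pointGroup Γ).1 x) = x := fun x =>
    (M : Orth n).apply_symm_apply x
  -- Chosen so that `M (ω + z) = M' ω'`: the isometry `[z, M'⁻¹M]` of `Γ*` then carries `ω` to `ω'`,
  -- so its image of `R` meets `R` and it must be the identity.
  set z := -((M⁻¹ : pointGroup Γ).1 ((M : Orth n) ω - (M' : Orth n) ω')) with hzdef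
  have hzmem : z ∈ dualLattice Γ := neg_mem (pointGroup_dualLattice (M⁻¹).2 hz)
  have hg := isoOf_mem_dualGroup hzmem (M'⁻¹ * M).2
  have hgω : isoOf z (M'⁻¹ * M : pointGroup Γ).1 ω = ω' := by
    rw [isoOf_apply]
    change (M'⁻¹ : pointGroup Γ).1 ((M : Orth n) (ω + z)) = ω'
    rw [map_add, hzdef, map_neg, hM, ← sub_eq_add_neg, sub_sub_cancel, hM']
  have hg1 : isoOf z (M'⁻¹ * M : pointGroup Γ).1 = 1 := by
    by_contra hne
    exact Set.disjoint_left.1 (hR.disjoint _ hg 1 (one_mem _) hne) ⟨ω, hω, hgω⟩ ⟨ω', hω', rfl⟩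
  refine ⟨by rw [hg1] at hgω; exact hgω, ?_⟩
  rw [← isoOf_zero_one] at hg1
  have h2 := congrArg Prod.snd (@isoOf_injective n (z, (M'⁻¹ * M : pointGroup Γ).1) (0, 1) hg1)
  exact (inv_mul_eq_one.1 (Subtype.ext h2)).symm

/-- `Ω \ R` lies in the boundary of `R`, a null set because `R` is convex. This allows integrals
over `Ω` to be taken over `R`, where the characters separate points. -/
lemma restrict_fundSet_eq (hR : IsFundDomain (dualGroup Γ) R) (hRconvex : Convex ℝ R)
    (hRΩ : R ⊆ Ω) (hΩR : Ω ⊆ closure R) :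
    (volume : Measure (EuclideanSpace ℝ (Fin n))).restrict Ω = volume.restrict R := by
  refine Measure.restrict_congr_set (Filter.EventuallyLE.antisymm ?_ hRΩ.eventuallyLE)
  rw [ae_le_set]
  refine measure_mono_null (fun x hx => ?_) (hRconvex.addHaar_frontier volume)
  rw [frontier, hR.isOpen.interior_eq]
  exact ⟨hΩR hx.1, hx.2⟩

end Geometry

/-! ### Fourier uniqueness for lattice characters and irreducibility. -/

section Irreducibility

open scoped BoundedContinuousFunction

variable {n : ℕ} {Γ : Subgroup (Iso n)}

/-- An integrable function is zero almost everywhere if its integrals against the characters of a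
lattice, pulled back by a map that is injective modulo the dual lattice, vanish. -/
lemma ae_eq_zero_of_forall_integral_fourierChar {E : Type*} [TopologicalSpace E] [PolishSpace E]
    [MeasurableSpace E] [BorelSpace E] (ν : Measure E) {θ : E → EuclideanSpace ℝ (Fin n)}
    (hθ : Continuous θ)
    (hsep : ∀ p q, (∀ y ∈ lattice Γ,
      Real.fourierChar ⟪θ p, y⟫_ℝ = Real.fourierChar ⟪θ q, y⟫_ℝ) → p = q)
    {f : E → ℂ} (hf : Integrable f ν)
    (h : ∀ y ∈ lattice Γ, ∫ p, (Real.fourierChar ⟪θ p, y⟫_ℝ : ℂ) * f p ∂ν = 0) : f =ᵐ[ν] 0 := by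
  let S : Submonoid (E →ᵇ ℂ) :=
    { carrier := {φ | ∃ y ∈ lattice Γ, ∀ p, φ p = (Real.fourierChar ⟪θ p, y⟫_ℝ : ℂ)}
      one_mem' := ⟨0, zero_mem _, fun p => by simp⟩
      mul_mem' := by
        rintro φ ψ ⟨y, hy, hφ⟩ ⟨z, hz, hψ⟩
        refine ⟨y + z, add_mem hy hz, fun p => ?_⟩
        rw [BoundedContinuousFunction.mul_apply, hφ, hψ, inner_add_right,
          AddChar.map_add_eq_mul, Circle.coe_mul] }
  have hS : ∀ y ∈ lattice Γ, ∃ φ ∈ S, ∀ p, φ p = (Real.fourierChar ⟪θ p, y⟫_ℝ : ℂ) := by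
    intro y hy
    have hc : Continuous fun p => (Real.fourierChar ⟪θ p, y⟫_ℝ : ℂ) :=
      continuous_subtype_val.comp (Real.continuous_fourierChar.comp (by fun_prop))
    exact ⟨BoundedContinuousFunction.ofNormedAddCommGroup _ hc 1 fun p => (Circle.norm_coe _).le,
      ⟨y, hy, fun p => rfl⟩, fun p => rfl⟩
  refine ae_eq_zero_of_forall_integral_submonoid ν S ?_ (fun p q hpq => ?_) hf ?_
  · rintro φ ⟨y, hy, hφ⟩
    refine ⟨-y, neg_mem hy, fun p => ?_⟩
    rw [BoundedContinuousFunction.star_apply, hφ, inner_neg_right, AddChar.map_neg_eq_inv,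
      Circle.coe_inv_eq_conj]
    rfl
  · refine hsep p q fun y hy => ?_
    obtain ⟨φ, hφ, h1⟩ := hS y hy
    have h2 := hpq φ hφ
    rw [h1, h1] at h2
    exact Subtype.ext h2
  · rintro φ ⟨y, hy, hφ⟩
    simp only [hφ]
    exact h y hy

variable {R : Set (EuclideanSpace ℝ (Fin n))}

/-- Orthogonality of `q` to all lattice translates of `p` says that the summable function `M ↦ ⟪q M,
p M⟫` has zero integral against every character at the points `Mω`, and these characters separate
`Π`. -/
lemma mul_eq_zero_of_orthogonal_invariant (hR : IsFundDomain (dualGroup Γ) R)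
    (γ : CrossSection Γ) {ω : EuclideanSpace ℝ (Fin n)} (hω : ω ∈ R)
    {K : ClosedSubmodule ℂ (l2Point Γ)} (hK : IsInvariant (indRep (chi Γ ω) γ) K)
    {p q : l2Point Γ} (hp : p ∈ K) (hq : q ∈ K.toSubmoduleᗮ) (M : pointGroup Γ) :
    ⟪q M, p M⟫_ℂ = 0 := by
  have := countable_pointGroup hR
  -- A countable discrete space is Polish, so the uniqueness lemma applies to counting measure.
  let : TopologicalSpace (pointGroup Γ) := ⊥
  have : DiscreteTopology (pointGroup Γ) := ⟨rfl⟩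
  let : MeasurableSpace (pointGroup Γ) := ⊤
  have hint : ∀ u : l2Point Γ,
      Integrable (fun M => ⟪q M, u M⟫_ℂ) (Measure.count : Measure (pointGroup Γ)) := fun u =>
    integrable_count_iff.2 (lp.summable_inner (𝕜 := ℂ) q u).norm
  have h := ae_eq_zero_of_forall_integral_fourierChar (Γ := Γ) Measure.count
    (θ := fun M : pointGroup Γ => (M : Orth n) ω) continuous_of_discreteTopology
    (fun M M' hM => (eq_of_forall_fourierChar_eq hR hω hω hM).2) (hint p) (fun y hy => by
      have h1 : ⟪q, indRep (chi Γ ω) γ (latticeTranslation hy : Γ) p⟫_ℂ = 0 :=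
        Submodule.inner_left_of_mem_orthogonal (hK _ p hp) hq
      rw [lp.inner_eq_tsum] at h1
      have h2 := integral_countable (hint (indRep (chi Γ ω) γ (latticeTranslation hy : Γ) p))
      simp only [count_real_singleton, one_smul] at h2
      rw [← h1, ← h2]
      refine integral_congr_ae (Eventually.of_forall fun M => ?_)
      change _ = ⟪q M, indRep (chi Γ ω) γ (latticeTranslation hy : Γ) p M⟫_ℂ
      rw [indRep_latticeTranslation]
      simp only [RCLike.inner_apply]
      ring)
  exact Measure.ae_count_iff.1 h M

/-- The induced representations at the points of a fundamental domain are irreducible. -/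
theorem isIrreducible_indRep (hR : IsFundDomain (dualGroup Γ) R) (γ : CrossSection Γ)
    {ω : EuclideanSpace ℝ (Fin n)} (hω : ω ∈ R) : IsIrreducible (indRep (chi Γ ω) γ) := by
  classical
  intro K hK
  have hspan : ∀ N : Submodule ℂ (l2Point Γ), IsClosed (N : Set (l2Point Γ)) →
      (∀ M : pointGroup Γ, lp.single 2 M (1 : ℂ) ∈ N) → N = ⊤ := by
    intro N hN h
    rw [Submodule.eq_top_iff']
    intro ζ
    refine hN.mem_of_tendsto (lp.hasSum_single (by norm_num) ζ)
      (Eventually.of_forall fun s => Submodule.sum_mem _ fun M _ => ?_)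
    have h1 := N.smul_mem (ζ M) (h M)
    rwa [← lp.single_smul, smul_eq_mul, mul_one] at h1
  -- The two components `p` and `q` of `e` have disjoint supports and sum to a vector supported at
  -- one point, so one of them is zero.
  set e : l2Point Γ := lp.single 2 (1 : pointGroup Γ) (1 : ℂ) with he
  set p := K.toSubmodule.starProjection e
  set q := e - p
  have hp : p ∈ K := Submodule.starProjection_apply_mem _ _
  have hq : q ∈ K.toSubmoduleᗮ := Submodule.sub_starProjection_mem_orthogonal _
  have hpq := mul_eq_zero_of_orthogonal_invariant hR γ hω hK hp hq
  have hsum : ∀ M, p M + q M = e M := fun M => by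
    change p M + (e M - p M) = e M
    ring
  have hcase : p = 0 ∨ q = 0 := by
    have hoff : ∀ M, M ≠ 1 → p M = 0 ∧ q M = 0 := fun M hM => by
      have h1 := hsum M
      have h2 : e M = 0 := by simp [he, lp.single_apply, hM]
      rw [h2] at h1
      have h3 : p M = - q M := eq_neg_of_add_eq_zero_left h1
      have h4 := hpq M
      rw [h3, inner_neg_right, neg_eq_zero, inner_self_eq_zero] at h4
      exact ⟨by rw [h3, h4, neg_zero], h4⟩
    have h1 := hpq 1
    rw [RCLike.inner_apply, mul_eq_zero, map_eq_zero] at h1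
    rcases h1 with h1 | h1
    · left
      ext M
      by_cases hM : M = 1
      · rw [hM, h1]; rfl
      · rw [(hoff M hM).1]; rfl
    · right
      ext M
      by_cases hM : M = 1
      · rw [hM, h1]; rfl
      · rw [(hoff M hM).2]; rfl
  rcases hcase with h0 | h0
  · left
    have heq : e ∈ K.toSubmoduleᗮ := by
      have : q = e := by simp [q, h0]
      rwa [this] at hq
    have htop : K.toSubmoduleᗮ = ⊤ := by
      refine hspan _ (Submodule.isClosed_orthogonal _) fun M => ?_
      rw [Submodule.mem_orthogonal]
      intro v hv
      -- The unitary operator of `γ(M)⁻¹` preserves `K` and takes the basis vector at `M` to `e`,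
      -- which is orthogonal to `K`.
      rw [← (indRep (chi Γ ω) γ (γ.toFun M)⁻¹).inner_map_map, indRep_crossSection_inv_single]
      exact (Submodule.mem_orthogonal _ _).1 heq _ (hK _ v hv)
    apply ClosedSubmodule.toSubmodule_injective
    rw [ClosedSubmodule.toSubmodule_bot]
    exact (Submodule.orthogonal_eq_top_iff _).1 htop
  · right
    have heK : e ∈ K := by
      rw [sub_eq_zero.1 h0]
      exact hp
    apply ClosedSubmodule.toSubmodule_injective
    refine hspan _ K.isClosed fun M => ?_
    rw [← indRep_crossSection_single (chi Γ ω) γ M 1]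
    exact hK _ e heK

end Irreducibility

/-! ### Elementary tensors and the subspaces `A ⊗ F`. -/

section TensorBasics

variable {A B : Type*} [NormedAddCommGroup A] [InnerProductSpace ℂ A]
  [NormedAddCommGroup B] [InnerProductSpace ℂ B]

lemma inner_elemTensor (a a' : A) (b b' : B) :
    ⟪elemTensor a b, elemTensor a' b'⟫_ℂ = ⟪a, a'⟫_ℂ * ⟪b, b'⟫_ℂ := by
  rw [elemTensor, elemTensor, UniformSpace.Completion.inner_coe, TensorProduct.inner_tmul]

lemma norm_elemTensor (a : A) (b : B) : ‖elemTensor a b‖ = ‖a‖ * ‖b‖ := by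
  rw [elemTensor, UniformSpace.Completion.norm_coe, TensorProduct.norm_tmul]

/-- `a ↦ a ⊗ b` as a bounded operator. -/
noncomputable def elemTensorLeft (A : Type*) [NormedAddCommGroup A] [InnerProductSpace ℂ A] (b : B) :
    A →L[ℂ] HilbertTensor A B :=
  LinearMap.mkContinuous
    { toFun := fun a => elemTensor a b
      map_add' := fun a a' => by
        simp only [elemTensor, TensorProduct.add_tmul, UniformSpace.Completion.coe_add]
      map_smul' := fun c a => by
        simp only [elemTensor, ← TensorProduct.smul_tmul', UniformSpace.Completion.coe_smul,
          RingHom.id_apply] } ‖b‖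
    (fun a => by
      rw [mul_comm]
      exact (norm_elemTensor a b).le)

lemma elemTensorLeft_apply (a : A) (b : B) : elemTensorLeft A b a = elemTensor a b := rfl

/-- A closed subspace that contains the elementary tensors is everything. -/
lemma mem_of_elemTensor_mem (K : ClosedSubmodule ℂ (HilbertTensor A B))
    (h : ∀ a b, elemTensor a b ∈ K) (v : HilbertTensor A B) : v ∈ K := by
  induction v using UniformSpace.Completion.induction_on with
  | hp => exact K.isClosed
  | ih x =>
    induction x using TensorProduct.induction_on with
    | zero => exact zero_mem _
    | tmul a b => exact h a b
    | add x y hx hy =>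
      rw [UniformSpace.Completion.coe_add]
      exact add_mem hx hy

lemma clm_ext_elemTensor {V : Type*} [NormedAddCommGroup V] [NormedSpace ℂ V]
    {S T : HilbertTensor A B →L[ℂ] V} (h : ∀ a b, S (elemTensor a b) = T (elemTensor a b)) :
    S = T := by
  ext v
  refine mem_of_elemTensor_mem ⟨LinearMap.eqLocus S.toLinearMap T.toLinearMap, ?_⟩ h v
  exact isClosed_eq S.continuous T.continuous

lemma elemTensor_mem_tensorSubspace {F : ClosedSubmodule ℂ B} (a : A) {b : B} (hb : b ∈ F) :
    elemTensor a b ∈ tensorSubspace A F :=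
  Submodule.le_topologicalClosure _ (Submodule.subset_span ⟨a, b, hb, rfl⟩)

lemma tensorSubspace_le {F : ClosedSubmodule ℂ B} {K : ClosedSubmodule ℂ (HilbertTensor A B)}
    (h : ∀ a, ∀ b ∈ F, elemTensor a b ∈ K) : tensorSubspace A F ≤ K := by
  refine Submodule.closure_le.2 (Submodule.span_le.2 ?_)
  rintro _ ⟨a, b, hb, rfl⟩
  exact h a b hb

/-- The subspaces `A ⊗ F` are invariant under the operators `u ⊗ I`. -/
lemma ampl_mem_tensorSubspace (F : ClosedSubmodule ℂ B) (u : A ≃ₗᵢ[ℂ] A) {v : HilbertTensor A B}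
    (hv : v ∈ tensorSubspace A F) : ampl B u v ∈ tensorSubspace A F := by
  refine tensorSubspace_le (K := (tensorSubspace A F).comap
    ((ampl B u : HilbertTensor A B ≃ₗᵢ[ℂ] HilbertTensor A B) :
      HilbertTensor A B →L[ℂ] HilbertTensor A B)) (fun a b hb => ?_) hv
  change ampl B u (elemTensor a b) ∈ tensorSubspace A F
  rw [ampl_elemTensor]
  exact elemTensor_mem_tensorSubspace _ hb

end TensorBasics

/-! ### Coordinates on `l² ⊗ B`. -/

section TensorCoordinates

variable {ι : Type*} [DecidableEq ι] {B : Type*} [NormedAddCommGroup B] [InnerProductSpace ℂ B]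

/-- The isometry `b ↦ e_i ⊗ b`. -/
noncomputable def basisTensor (i : ι) : B →ₗᵢ[ℂ] HilbertTensor (lp (fun _ : ι => ℂ) 2) B where
  toFun b := elemTensor (lp.single 2 i 1) b
  map_add' b b' := by
    simp only [elemTensor, TensorProduct.tmul_add, UniformSpace.Completion.coe_add]
  map_smul' c b := by
    simp only [elemTensor, TensorProduct.tmul_smul, UniformSpace.Completion.coe_smul,
      RingHom.id_apply]
  norm_map' b := by
    change ‖elemTensor _ b‖ = _
    rw [norm_elemTensor, lp.norm_single (by norm_num), norm_one, one_mul]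

lemma basisTensor_apply (i : ι) (b : B) :
    basisTensor i b = elemTensor (lp.single 2 i 1 : lp (fun _ : ι => ℂ) 2) b := rfl

lemma elemTensor_mem_of_basisTensor_mem
    {K : ClosedSubmodule ℂ (HilbertTensor (lp (fun _ : ι => ℂ) 2) B)} {b : B}
    (h : ∀ i, basisTensor i b ∈ K) (a : lp (fun _ : ι => ℂ) 2) : elemTensor a b ∈ K := by
  have hs := (lp.hasSum_single (by norm_num) a).mapL (elemTensorLeft (lp (fun _ : ι => ℂ) 2) b)
  refine K.isClosed.mem_of_tendsto hs (Eventually.of_forall fun s => sum_mem fun i _ => ?_)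
  have h1 := K.smul_mem (a i) (h i)
  rwa [basisTensor_apply, ← elemTensorLeft_apply, ← map_smul, ← lp.single_smul, smul_eq_mul,
    mul_one] at h1

lemma orthogonalFamily_basisTensor :
    OrthogonalFamily ℂ (fun _ : ι => B) (fun i : ι => (basisTensor i : B →ₗᵢ[ℂ] _)) := by
  intro i j hij b b'
  rw [basisTensor_apply, basisTensor_apply, inner_elemTensor, lp.inner_single_left]
  simp [lp.single_apply, hij]

variable [CompleteSpace B]

/-- Identifies `l² ⊗ B` with the Hilbert sum of copies of `B`, one for each basis vector; Parseval's
identity for the coordinates comes from this. -/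
lemma isHilbertSum_basisTensor :
    IsHilbertSum ℂ (fun _ : ι => B) (fun i : ι => (basisTensor i : B →ₗᵢ[ℂ] _)) := by
  refine IsHilbertSum.mk orthogonalFamily_basisTensor fun v _ => ?_
  refine mem_of_elemTensor_mem ⟨_, Submodule.isClosed_topologicalClosure _⟩ (fun a b => ?_) v
  refine elemTensor_mem_of_basisTensor_mem (fun i => Submodule.le_topologicalClosure _ ?_) a
  exact Submodule.mem_iSup_of_mem i ⟨b, rfl⟩

/-- The coordinate of a tensor at the basis vector `e_i`. -/
noncomputable def tensorCoord (i : ι) : HilbertTensor (lp (fun _ : ι => ℂ) 2) B →L[ℂ] B :=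
  ContinuousLinearMap.adjoint (basisTensor i : B →ₗᵢ[ℂ] _).toContinuousLinearMap

lemma inner_tensorCoord_left (i : ι) (v : HilbertTensor (lp (fun _ : ι => ℂ) 2) B) (b : B) :
    ⟪tensorCoord i v, b⟫_ℂ = ⟪v, basisTensor i b⟫_ℂ :=
  ContinuousLinearMap.adjoint_inner_left _ _ _

lemma tensorCoord_elemTensor (i : ι) (a : lp (fun _ : ι => ℂ) 2) (b : B) :
    tensorCoord i (elemTensor a b) = a i • b := by
  refine ext_inner_right ℂ fun b' => ?_
  rw [inner_tensorCoord_left, basisTensor_apply, inner_elemTensor, lp.inner_single_right,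
    inner_smul_left]
  simp

/-- Parseval's identity for the coordinates. -/
lemma hasSum_inner_tensorCoord (v w : HilbertTensor (lp (fun _ : ι => ℂ) 2) B) :
    HasSum (fun i => ⟪tensorCoord i v, tensorCoord i w⟫_ℂ) ⟪v, w⟫_ℂ := by
  have hc : ∀ v i, (isHilbertSum_basisTensor (ι := ι) (B := B)).linearIsometryEquiv v i =
      tensorCoord i v := fun v i => by
    refine ext_inner_right ℂ fun b => ?_
    rw [inner_tensorCoord_left, ← lp.inner_single_right,
      ← (isHilbertSum_basisTensor (ι := ι) (B := B)).linearIsometryEquiv_symm_apply_single,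
      ← LinearIsometryEquiv.inner_map_map
        (isHilbertSum_basisTensor (ι := ι) (B := B)).linearIsometryEquiv,
      LinearIsometryEquiv.apply_symm_apply]
  have h := lp.hasSum_inner (𝕜 := ℂ)
    ((isHilbertSum_basisTensor (ι := ι) (B := B)).linearIsometryEquiv v)
    ((isHilbertSum_basisTensor (ι := ι) (B := B)).linearIsometryEquiv w)
  rw [LinearIsometryEquiv.inner_map_map] at h
  simpa only [hc] using h

lemma eq_zero_of_tensorCoord_eq_zero {v : HilbertTensor (lp (fun _ : ι => ℂ) 2) B}
    (h : ∀ i, tensorCoord i v = 0) : v = 0 := by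
  have h1 := hasSum_inner_tensorCoord v v
  simp only [h, inner_zero_left] at h1
  exact inner_self_eq_zero.1 (h1.unique hasSum_zero)

/-- A closed subspace that is stable under the coordinate projections and under moving a coordinate
to another place is of the form `l² ⊗ F`. -/
lemma eq_tensorSubspace (K : ClosedSubmodule ℂ (HilbertTensor (lp (fun _ : ι => ℂ) 2) B)) (j : ι)
    (hcoord : ∀ i, ∀ v ∈ K, basisTensor i (tensorCoord i v) ∈ K)
    (hmove : ∀ i (b : B), basisTensor i b ∈ K ↔ basisTensor j b ∈ K) :
    K = tensorSubspace (lp (fun _ : ι => ℂ) 2)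
      (K.comap (basisTensor j : B →ₗᵢ[ℂ] _).toContinuousLinearMap) := by
  set N := tensorSubspace (lp (fun _ : ι => ℂ) 2)
    (K.comap (basisTensor j : B →ₗᵢ[ℂ] _).toContinuousLinearMap) with hN
  have hle : N ≤ K := tensorSubspace_le fun a b hb =>
    elemTensor_mem_of_basisTensor_mem (fun i => (hmove i b).2 hb) a
  refine le_antisymm (fun v hv => ?_) hle
  have hp : N.toSubmodule.starProjection v ∈ N := Submodule.starProjection_apply_mem _ _
  have hq := Submodule.sub_starProjection_mem_orthogonal (K := N.toSubmodule) v
  set q := v - N.toSubmodule.starProjection v with hqdef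
  have hqK : q ∈ K := Submodule.sub_mem K.toSubmodule hv (hle hp)
  -- For each `i` the vector `e_i ⊗ q_i` lies in `l² ⊗ F`, to which `q` is orthogonal, so `‖q_i‖² =
  -- ⟪q, e_i ⊗ q_i⟫ = 0`.
  have hq0 : q = 0 := by
    refine eq_zero_of_tensorCoord_eq_zero fun i => ?_
    have h1 : basisTensor i (tensorCoord i q) ∈ N :=
      elemTensor_mem_tensorSubspace _ ((hmove i _).1 (hcoord i q hqK))
    have h2 := Submodule.inner_left_of_mem_orthogonal h1 hq
    rw [← inner_tensorCoord_left] at h2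
    exact inner_self_eq_zero.1 h2
  rw [hqdef, sub_eq_zero] at hq0
  rw [hq0]
  exact hp

end TensorCoordinates

/-! ### Separability of the fibre space. -/

section Separability

/-- The Hilbert space tensor product of two `l²` spaces over countable sets is separable. -/
lemma separableSpace_hilbertTensor (ι κ : Type*) [Countable ι] [Countable κ] :
    TopologicalSpace.SeparableSpace
      (HilbertTensor (lp (fun _ : ι => ℂ) 2) (lp (fun _ : κ => ℂ) 2)) := by
  classical
  let D : Set (HilbertTensor (lp (fun _ : ι => ℂ) 2) (lp (fun _ : κ => ℂ) 2)) :=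
    Set.range fun p : ι × κ => basisTensor p.1 (lp.single 2 p.2 1)
  have hD : (Submodule.span ℂ D).closure = ⊤ := by
    refine top_unique fun v _ => ?_
    refine mem_of_elemTensor_mem _ (fun a b => ?_) v
    refine elemTensor_mem_of_basisTensor_mem (fun i => ?_) a
    have hs := (lp.hasSum_single (by norm_num) b).mapL
      (basisTensor i : lp (fun _ : κ => ℂ) 2 →ₗᵢ[ℂ]
        HilbertTensor (lp (fun _ : ι => ℂ) 2) _).toContinuousLinearMap
    refine (Submodule.span ℂ D).closure.isClosed.mem_of_tendsto hs
      (Eventually.of_forall fun s => sum_mem fun k _ => ?_)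
    have h1 : basisTensor i (lp.single 2 k 1) ∈ (Submodule.span ℂ D).closure :=
      Submodule.le_topologicalClosure _ (Submodule.subset_span ⟨(i, k), rfl⟩)
    have h2 := (Submodule.span ℂ D).closure.smul_mem (b k) h1
    rwa [← map_smul, ← lp.single_smul, smul_eq_mul, mul_one] at h2
  rw [← TopologicalSpace.isSeparable_univ_iff]
  have h := ((Set.countable_range _).isSeparable.span (R := ℂ) (s := D)).closure
  convert h
  exact (congrArg SetLike.coe hD).symm

end Separability

/-! ### Range functions and cutting measurable fields into square integrable pieces. -/

section RangeFunctions

variable {X H : Type*} [NormedAddCommGroup H] [InnerProductSpace ℂ H]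

lemma mem_rangeFunction {ι : Type*} {𝒜 : Set ι} (f : ι → X → H) {Φ : ι} (hΦ : Φ ∈ 𝒜) (x : X) :
    f Φ x ∈ rangeFunction 𝒜 f x :=
  Submodule.le_topologicalClosure _ (Submodule.subset_span ⟨Φ, hΦ, rfl⟩)

lemma rangeFunction_le {ι : Type*} {𝒜 : Set ι} {f : ι → X → H} {x : X} {K : ClosedSubmodule ℂ H}
    (h : ∀ Φ ∈ 𝒜, f Φ x ∈ K) : rangeFunction 𝒜 f x ≤ K := by
  refine Submodule.closure_le.2 (Submodule.span_le.2 ?_)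
  rintro _ ⟨Φ, hΦ, rfl⟩
  exact h Φ hΦ

end RangeFunctions

/-- A strongly measurable function is square integrable on each set of a countable cover. -/
lemma exists_cover_memLp_indicator {X H : Type*} [MeasurableSpace X] {μ : Measure X}
    [NormedAddCommGroup H] [SigmaFinite μ] {g : X → H} (hg : StronglyMeasurable g) :
    ∃ s : ℕ → Set X, (∀ k, MeasurableSet (s k)) ∧ (⋃ k, s k) = Set.univ ∧
      ∀ k, MemLp ((s k).indicator g) 2 μ := by
  have hs : ∀ k : ℕ, MeasurableSet (spanningSets μ k ∩ {x | ‖g x‖ ≤ k}) := fun k =>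
    (measurableSet_spanningSets μ k).inter (measurableSet_le hg.norm.measurable measurable_const)
  refine ⟨fun k => spanningSets μ k ∩ {x | ‖g x‖ ≤ k}, hs, ?_, fun k => ?_⟩
  · refine Set.eq_univ_of_forall fun x => ?_
    obtain ⟨k, hk⟩ := Set.mem_iUnion.1 ((iUnion_spanningSets μ).symm ▸ Set.mem_univ x)
    obtain ⟨l, hl⟩ := exists_nat_ge ‖g x‖
    refine Set.mem_iUnion.2 ⟨max k l, monotone_spanningSets μ (le_max_left k l) hk, ?_⟩
    exact hl.trans (Nat.cast_le.2 (le_max_right k l))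
  · rw [memLp_indicator_iff_restrict (hs k)]
    have : IsFiniteMeasure (μ.restrict (spanningSets μ k ∩ {x | ‖g x‖ ≤ k})) := by
      refine isFiniteMeasure_restrict.2 (ne_of_lt ?_)
      exact (measure_mono Set.inter_subset_left).trans_lt (measure_spanningSets_lt_top μ k)
    refine MemLp.of_bound hg.aestronglyMeasurable k ?_
    filter_upwards [ae_restrict_mem (hs k)] with x hx using hx.2

/-- Orthonormal vectors are at distance `√2`, so the balls of radius `1/2` around them are disjoint.
-/
lemma countable_of_orthonormal {H : Type*} [NormedAddCommGroup H]
    [InnerProductSpace ℂ H] [TopologicalSpace.SeparableSpace H] {ι : Type*}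
    {e : ι → H} (he : Orthonormal ℂ e) : Countable ι := by
  refine Pairwise.countable_of_isOpen_disjoint (s := fun i => Metric.ball (e i) (1 / 2))
    (fun i j hij => ?_) (fun i => Metric.isOpen_ball)
    (fun i => Metric.nonempty_ball.2 (by norm_num))
  refine Metric.ball_disjoint_ball ?_
  have h1 := @norm_sub_sq ℂ H _ _ _ (e i) (e j)
  rw [he.1 i, he.1 j, he.2 hij] at h1
  rw [dist_eq_norm]
  norm_num at h1 ⊢
  nlinarith [norm_nonneg (e i - e j)]

/-! ### Subspaces pointwise orthogonal to their complement, and their range functions. -/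

section DecomposableSubspaces

variable {X H : Type*} [MeasurableSpace X] {μ : Measure X} [NormedAddCommGroup H]
  [InnerProductSpace ℂ H]

lemma mem_directIntegral {J : X → ClosedSubmodule ℂ H} {ξ : Lp H 2 μ} :
    ξ ∈ directIntegral μ J ↔ ∀ᵐ x ∂μ, ξ x ∈ J x := Iff.rfl

lemma isInvariant_directIntegralRep {G : Type*} [Group G] {ρ : X → G →* (H ≃ₗᵢ[ℂ] H)}
    (h : IsMeasurableRepField μ ρ) {J : X → ClosedSubmodule ℂ H}
    (hJ : ∀ᵐ x ∂μ, IsInvariant (ρ x) (J x)) :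
    IsInvariant (directIntegralRep ρ h) (directIntegral μ J) := by
  intro g ξ hξ
  rw [mem_directIntegral] at hξ ⊢
  filter_upwards [hJ, hξ, directIntegralOp_coeFn _ (h g) ξ] with x h1 h2 h3
  change directIntegralOp _ (h g) ξ x ∈ J x
  rw [h3]
  exact h1 g _ h2

variable [CompleteSpace H]

/-- Vectors of `W` and of its orthogonal complement are orthogonal at almost every point. -/
def IsPointwiseOrthogonal (W : ClosedSubmodule ℂ (Lp H 2 μ)) : Prop :=
  ∀ ξ ∈ W, ∀ η ∈ W.toSubmoduleᗮ, ∀ᵐ x ∂μ, ⟪η x, ξ x⟫_ℂ = 0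

variable {W : ClosedSubmodule ℂ (Lp H 2 μ)} {J : X → ClosedSubmodule ℂ H}

/-- Valid for every closed `W`: the vectors `Φ` with `P_W Φ` in the direct integral form a closed
set containing the dense set `𝒜`. -/
lemma IsAssociatedRangeFunction.le_directIntegral (hJ : IsAssociatedRangeFunction W J) :
    W ≤ directIntegral μ J := by
  obtain ⟨𝒜, f, -, hdense, hf, rfl⟩ := hJ
  intro ξ hξ
  have hcl : IsClosed {Φ : Lp H 2 μ |
      W.toSubmodule.starProjection Φ ∈ directIntegral μ (rangeFunction 𝒜 f)} :=
    (directIntegral μ (rangeFunction 𝒜 f)).isClosed.preimage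
      W.toSubmodule.starProjection.continuous
  have hsub : 𝒜 ⊆ {Φ : Lp H 2 μ |
      W.toSubmodule.starProjection Φ ∈ directIntegral μ (rangeFunction 𝒜 f)} := fun Φ hΦ => by
    filter_upwards [hf Φ hΦ] with x hx
    rw [← hx]
    exact mem_rangeFunction f hΦ x
  have h1 := hcl.closure_subset_iff.2 hsub (hdense ξ)
  rwa [Set.mem_ofPred_eq, Submodule.starProjection_eq_self_iff.2 hξ] at h1

/-- Countability of `𝒜` yields one null set outside which `η x` is orthogonal to all generators of
`J x`. -/
lemma IsAssociatedRangeFunction.ae_mem_orthogonal (hJ : IsAssociatedRangeFunction W J)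
    (hW : IsPointwiseOrthogonal W) {η : Lp H 2 μ} (hη : η ∈ W.toSubmoduleᗮ) :
    ∀ᵐ x ∂μ, η x ∈ (J x).toSubmoduleᗮ := by
  obtain ⟨𝒜, f, hcount, -, hf, rfl⟩ := hJ
  have h1 : ∀ᵐ x ∂μ, ∀ Φ ∈ 𝒜, ⟪η x, f Φ x⟫_ℂ = 0 := by
    rw [ae_ball_iff hcount]
    intro Φ hΦ
    filter_upwards [hf Φ hΦ, hW _ (Submodule.starProjection_apply_mem _ Φ) η hη] with x h1 h2
    rw [h1, h2]
  filter_upwards [h1] with x hx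
  have h2 : rangeFunction 𝒜 f x ≤ ⟨(Submodule.span ℂ {η x})ᗮ, Submodule.isClosed_orthogonal _⟩ :=
    rangeFunction_le fun Φ hΦ => Submodule.mem_orthogonal_singleton_iff_inner_right.2 (hx Φ hΦ)
  intro v hv
  exact Submodule.mem_orthogonal_singleton_iff_inner_left.1 (h2 hv)

/-- At almost every `x` the splitting of `ξ` along `W` evaluates to a splitting of `ξ x` along `J x`
and its complement, and such a splitting is unique. -/
lemma IsAssociatedRangeFunction.starProjection_ae_eq (hJ : IsAssociatedRangeFunction W J)
    (hW : IsPointwiseOrthogonal W) (ξ : Lp H 2 μ) :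
    (fun x => (J x).toSubmodule.starProjection (ξ x)) =ᵐ[μ] W.toSubmodule.starProjection ξ := by
  have h1 := hJ.le_directIntegral (Submodule.starProjection_apply_mem W.toSubmodule ξ)
  have h2 := hJ.ae_mem_orthogonal hW (Submodule.sub_starProjection_mem_orthogonal ξ)
  filter_upwards [h1, h2, Lp.coeFn_sub ξ (W.toSubmodule.starProjection ξ)] with x h1 h2 h3
  rw [h3] at h2
  exact Submodule.eq_starProjection_of_mem_orthogonal h1 h2

lemma IsAssociatedRangeFunction.eq_directIntegral (hJ : IsAssociatedRangeFunction W J)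
    (hW : IsPointwiseOrthogonal W) : W = directIntegral μ J := by
  refine le_antisymm hJ.le_directIntegral fun ξ hξ => ?_
  refine Submodule.starProjection_eq_self_iff.1 (Lp.ext ?_)
  filter_upwards [hJ.starProjection_ae_eq hW ξ, mem_directIntegral.1 hξ] with x h1 h2
  rw [← h1]
  exact Submodule.starProjection_eq_self_iff.2 h2

/-- Measurability is inherited from `P_W`: on each piece where `ξ` is square integrable, the
projected field is the image of an `L²` vector under `P_W`. -/
lemma IsAssociatedRangeFunction.isBoundedMeasurableField [SigmaFinite μ]
    (hJ : IsAssociatedRangeFunction W J) (hW : IsPointwiseOrthogonal W) :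
    IsBoundedMeasurableField μ fun x => (J x).toSubmodule.starProjection := by
  refine ⟨fun ξ hξ => ?_, 1, Eventually.of_forall fun x => Submodule.starProjection_norm_le _⟩
  obtain ⟨s, hs, hunion, hmem⟩ := exists_cover_memLp_indicator (μ := μ) hξ.stronglyMeasurable_mk
  have key : AEStronglyMeasurable (fun x => (J x).toSubmodule.starProjection (ξ x))
      (μ.restrict (⋃ k, s k)) := by
    rw [aestronglyMeasurable_iUnion_iff]
    intro k
    have h1 : AEStronglyMeasurable (W.toSubmodule.starProjection ((hmem k).toLp _))
        (μ.restrict (s k)) := (Lp.aestronglyMeasurable _).restrict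
    refine h1.congr ?_
    filter_upwards [ae_restrict_of_ae (hJ.starProjection_ae_eq hW ((hmem k).toLp _)),
      ae_restrict_of_ae (hmem k).coeFn_toLp, ae_restrict_of_ae hξ.ae_eq_mk,
      ae_restrict_mem (hs k)] with x h1 h2 h3 h4
    rw [← h1, h2, Set.indicator_of_mem h4, ← h3]
  rwa [hunion, Measure.restrict_univ] at key

lemma IsAssociatedRangeFunction.starProjection_eq [SigmaFinite μ]
    (hJ : IsAssociatedRangeFunction W J) (hW : IsPointwiseOrthogonal W) :
    W.toSubmodule.starProjection =
      directIntegralOp _ (hJ.isBoundedMeasurableField hW) := by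
  ext1 ξ
  apply Lp.ext
  filter_upwards [hJ.starProjection_ae_eq hW ξ,
    directIntegralOp_coeFn _ (hJ.isBoundedMeasurableField hW) ξ] with x h1 h2
  rw [← h1, h2]

lemma IsBoundedMeasurableField.isMeasurableRangeFunction
    (h : IsBoundedMeasurableField μ fun x => (J x).toSubmodule.starProjection) :
    IsMeasurableRangeFunction μ J := fun _ b =>
  (aestronglyMeasurable_const.inner (h.meas (fun _ => b) aestronglyMeasurable_const)).aemeasurable

/-- An operator field whose direct integral maps `W` to itself maps almost every `J x` to itself. -/
lemma IsAssociatedRangeFunction.ae_mapsTo (hJ : IsAssociatedRangeFunction W J)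
    {T : X → H →L[ℂ] H} (hT : IsBoundedMeasurableField μ T)
    (hTW : ∀ ξ ∈ W, directIntegralOp T hT ξ ∈ W) : ∀ᵐ x ∂μ, ∀ v ∈ J x, T x v ∈ J x := by
  have hle := hJ.le_directIntegral
  obtain ⟨𝒜, f, hcount, -, hf, rfl⟩ := hJ
  have h1 : ∀ᵐ x ∂μ, ∀ Φ ∈ 𝒜, T x (f Φ x) ∈ rangeFunction 𝒜 f x := by
    rw [ae_ball_iff hcount]
    intro Φ hΦ
    filter_upwards [hf Φ hΦ, hle (hTW _ (Submodule.starProjection_apply_mem _ Φ)),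
      directIntegralOp_coeFn T hT (W.toSubmodule.starProjection Φ)] with x h1 h2 h3
    rwa [h1, ← h3]
  filter_upwards [h1] with x hx v hv
  exact rangeFunction_le (K := (rangeFunction 𝒜 f x).comap (T x)) hx hv

lemma exists_isAssociatedRangeFunction [TopologicalSpace.SeparableSpace H] [MeasureTheory.IsSeparable μ]
    (W : ClosedSubmodule ℂ (Lp H 2 μ)) : ∃ J, IsAssociatedRangeFunction W J := by
  have : Fact ((2 : ℝ≥0∞) ≠ ∞) := ⟨ENNReal.ofNat_ne_top⟩
  obtain ⟨𝒜, hcount, hdense⟩ := TopologicalSpace.exists_countable_dense (Lp H 2 μ)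
  exact ⟨_, 𝒜, fun Φ => W.toSubmodule.starProjection Φ, hcount, hdense,
    fun Φ _ => EventuallyEq.rfl, rfl⟩

/-- In a separable Hilbert space, weak measurability implies strong measurability. -/
lemma aestronglyMeasurable_of_inner [TopologicalSpace.SeparableSpace H] {v : X → H}
    (h : ∀ a : H, AEMeasurable (fun x => ⟪a, v x⟫_ℂ) μ) : AEStronglyMeasurable v μ := by
  obtain ⟨w, e, -⟩ := exists_hilbertBasis ℂ H
  have := countable_of_orthonormal e.orthonormal
  refine aestronglyMeasurable_of_tendsto_ae (atTop : Filter (Finset w))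
    (f := fun s x => ∑ i ∈ s, e.repr (v x) i • e i) (fun s => ?_)
    (Eventually.of_forall fun x => e.hasSum_repr (v x))
  refine Finset.aestronglyMeasurable_fun_sum s fun i _ => ?_
  simp only [e.repr_apply_apply]
  exact (h (e i)).aestronglyMeasurable.smul_const (e i)

/-- A measurable field of subspaces is determined by its direct integral. -/
lemma ae_le_of_directIntegral_le [TopologicalSpace.SeparableSpace H] [SigmaFinite μ]
    {J J' : X → ClosedSubmodule ℂ H} (hJ : IsMeasurableRangeFunction μ J)
    (hle : directIntegral μ J ≤ directIntegral μ J') : ∀ᵐ x ∂μ, J x ≤ J' x := by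
  -- The field of projections of a fixed `b` is cut into `L²` pieces, each of which lies in the
  -- direct integral of `J`, hence in that of `J'`. A countable dense set of `b` then gives a single
  -- null set for all `b`.
  have hmem : ∀ b : H, ∀ᵐ x ∂μ, (J x).toSubmodule.starProjection b ∈ J' x := by
    intro b
    have hm : AEStronglyMeasurable (fun x => (J x).toSubmodule.starProjection b) μ :=
      aestronglyMeasurable_of_inner fun a => hJ a b
    obtain ⟨s, hs, hunion, hLp⟩ := exists_cover_memLp_indicator (μ := μ) hm.stronglyMeasurable_mk
    have h1 : ∀ k, ∀ᵐ x ∂μ, x ∈ s k → (J x).toSubmodule.starProjection b ∈ J' x := by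
      intro k
      have h2 : (hLp k).toLp _ ∈ directIntegral μ J := by
        rw [mem_directIntegral]
        filter_upwards [(hLp k).coeFn_toLp, hm.ae_eq_mk] with x h3 h4
        rw [h3]
        by_cases hx : x ∈ s k
        · rw [Set.indicator_of_mem hx, ← h4]
          exact Submodule.starProjection_apply_mem _ b
        · rw [Set.indicator_of_notMem hx]
          exact zero_mem _
      filter_upwards [mem_directIntegral.1 (hle h2), (hLp k).coeFn_toLp, hm.ae_eq_mk]
        with x h3 h4 h5 hx
      rwa [h4, Set.indicator_of_mem hx, ← h5] at h3
    filter_upwards [ae_all_iff.2 h1] with x hx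
    obtain ⟨k, hk⟩ := Set.mem_iUnion.1 (hunion.symm ▸ Set.mem_univ x)
    exact hx k hk
  obtain ⟨D, hcount, hdense⟩ := TopologicalSpace.exists_countable_dense H
  filter_upwards [(ae_ball_iff hcount).2 fun b _ => hmem b] with x hx v hv
  have hcl : IsClosed {b | (J x).toSubmodule.starProjection b ∈ J' x} :=
    (J' x).isClosed.preimage (J x).toSubmodule.starProjection.continuous
  have h1 := hcl.closure_subset_iff.2 hx (hdense v)
  rwa [Set.mem_ofPred_eq, Submodule.starProjection_eq_self_iff.2 hv] at h1

end DecomposableSubspaces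

/-! ### Diagonal operators and integrability in coordinates. -/

section TensorFields

variable {ι : Type*} [DecidableEq ι] {B : Type*} [NormedAddCommGroup B]
  [InnerProductSpace ℂ B]

lemma ampl_basisTensor {T : lp (fun _ : ι => ℂ) 2 ≃ₗᵢ[ℂ] lp (fun _ : ι => ℂ) 2} {i j : ι}
    (hT : T (lp.single 2 i 1) = lp.single 2 j 1) (b : B) :
    ampl B T (basisTensor i b) = basisTensor j b := by
  rw [basisTensor_apply, ampl_elemTensor, hT, basisTensor_apply]

variable [CompleteSpace B]

lemma tensorCoord_ampl {T : lp (fun _ : ι => ℂ) 2 ≃ₗᵢ[ℂ] lp (fun _ : ι => ℂ) 2} {i : ι} {c : ℂ}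
    (hT : ∀ a, T a i = c * a i) (v : HilbertTensor (lp (fun _ : ι => ℂ) 2) B) :
    tensorCoord i (ampl B T v) = c • tensorCoord i v := by
  have h : tensorCoord i ∘L ((ampl B T).toContinuousLinearEquiv :
      HilbertTensor (lp (fun _ : ι => ℂ) 2) B →L[ℂ] HilbertTensor (lp (fun _ : ι => ℂ) 2) B) =
      c • tensorCoord i := by
    refine clm_ext_elemTensor fun a b => ?_
    change tensorCoord i (ampl B T (elemTensor a b)) = c • tensorCoord i (elemTensor a b)
    rw [ampl_elemTensor, tensorCoord_elemTensor, tensorCoord_elemTensor, hT, mul_smul]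
  exact DFunLike.congr_fun h v

/-- Parseval's identity for a matrix coefficient of an amplified diagonal operator. -/
lemma hasSum_inner_ampl {T : lp (fun _ : ι => ℂ) 2 ≃ₗᵢ[ℂ] lp (fun _ : ι => ℂ) 2} {c : ι → ℂ}
    (hT : ∀ i a, T a i = c i * a i) (v w : HilbertTensor (lp (fun _ : ι => ℂ) 2) B) :
    HasSum (fun i => c i * ⟪tensorCoord i v, tensorCoord i w⟫_ℂ) ⟪v, ampl B T w⟫_ℂ := by
  have h := hasSum_inner_tensorCoord v (ampl B T w)
  simpa only [tensorCoord_ampl (hT _), inner_smul_right] using h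

lemma hasSum_norm_sq_tensorCoord (v : HilbertTensor (lp (fun _ : ι => ℂ) 2) B) :
    HasSum (fun i => ‖tensorCoord i v‖ ^ 2) (‖v‖ ^ 2) := by
  have h := hasSum_inner_tensorCoord v v
  simp only [inner_self_eq_norm_sq_to_K] at h
  exact_mod_cast h

/-- By Parseval, the sum over `i` of the absolute values at `x` is at most `‖v x‖² + ‖u x‖²`, which
is integrable. -/
lemma integrable_inner_tensorCoord {E : Type*} [MeasurableSpace E] {ν : Measure E} [SFinite ν]
    [Countable ι] [MeasurableSpace ι] [MeasurableSingletonClass ι]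
    {u v : E → HilbertTensor (lp (fun _ : ι => ℂ) 2) B} (hu : StronglyMeasurable u)
    (hv : StronglyMeasurable v) (hu2 : MemLp u 2 ν) (hv2 : MemLp v 2 ν) :
    Integrable (fun p : E × ι => ⟪tensorCoord p.2 (v p.1), tensorCoord p.2 (u p.1)⟫_ℂ)
      (ν.prod Measure.count) := by
  have hm : Measurable fun p : E × ι => ⟪tensorCoord p.2 (v p.1), tensorCoord p.2 (u p.1)⟫_ℂ :=
    measurable_from_prod_countable_left fun i =>
      (((tensorCoord i).continuous.comp_stronglyMeasurable hv).inner (𝕜 := ℂ)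
        ((tensorCoord i).continuous.comp_stronglyMeasurable hu)).measurable
  have hsum : ∀ x, Summable fun i => ‖⟪tensorCoord i (v x), tensorCoord i (u x)⟫_ℂ‖ := fun x =>
    (hasSum_inner_tensorCoord (v x) (u x)).summable.norm
  rw [integrable_prod_iff hm.aestronglyMeasurable]
  refine ⟨Eventually.of_forall fun x => integrable_count_iff.2 (hsum x), ?_⟩
  have hu3 : Integrable (fun x => ‖u x‖ ^ 2) ν := (memLp_two_iff_integrable_sq_norm hu2.1).1 hu2
  have hv3 : Integrable (fun x => ‖v x‖ ^ 2) ν := (memLp_two_iff_integrable_sq_norm hv2.1).1 hv2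
  refine (hv3.add hu3).mono' hm.stronglyMeasurable.norm.integral_prod_right'.aestronglyMeasurable
    (Eventually.of_forall fun x => ?_)
  have h1 := integral_countable (integrable_count_iff.2 (hsum x)).norm
  simp only [count_real_singleton, one_smul] at h1
  have h2 := (hasSum_norm_sq_tensorCoord (v x)).add (hasSum_norm_sq_tensorCoord (u x))
  rw [Real.norm_of_nonneg (integral_nonneg fun i => norm_nonneg _), h1]
  refine hasSum_le (fun i => ?_) (hsum x).hasSum h2
  refine (norm_inner_le_norm _ _).trans ?_
  nlinarith [sq_nonneg (‖tensorCoord i (v x)‖ - ‖tensorCoord i (u x)‖),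
    sq_nonneg ‖tensorCoord i (v x)‖, sq_nonneg ‖tensorCoord i (u x)‖]

end TensorFields

/-! ### Fourier uniqueness for vector fields. -/

section Orthogonality

variable {n : ℕ} {Γ : Subgroup (Iso n)}

/-- Two square integrable fields that are orthogonal under a family of diagonal operator fields
given by separating lattice characters have pointwise orthogonal coordinates. -/
lemma ae_inner_tensorCoord_eq_zero {E ι B : Type*} [TopologicalSpace E] [PolishSpace E]
    [MeasurableSpace E] [BorelSpace E] [Countable ι] [DecidableEq ι] [NormedAddCommGroup B]
    [InnerProductSpace ℂ B] [CompleteSpace B] {ν : Measure E} [SFinite ν]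
    {θ : ι → E → EuclideanSpace ℝ (Fin n)} (hθ : ∀ i, Continuous (θ i))
    (hsep : ∀ x x' i i', (∀ y ∈ lattice Γ, Real.fourierChar ⟪θ i x, y⟫_ℝ =
      Real.fourierChar ⟪θ i' x', y⟫_ℝ) → x = x' ∧ i = i')
    {T : lattice Γ → E → (lp (fun _ : ι => ℂ) 2 ≃ₗᵢ[ℂ] lp (fun _ : ι => ℂ) 2)}
    (hT : ∀ y x i a, T y x a i = (Real.fourierChar ⟪θ i x, (y : EuclideanSpace ℝ (Fin n))⟫_ℝ : ℂ) *
      a i)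
    {u v : E → HilbertTensor (lp (fun _ : ι => ℂ) 2) B} (hu : StronglyMeasurable u)
    (hv : StronglyMeasurable v) (hu2 : MemLp u 2 ν) (hv2 : MemLp v 2 ν)
    (h : ∀ y, ∫ x, ⟪v x, ampl B (T y x) (u x)⟫_ℂ ∂ν = 0) :
    ∀ᵐ x ∂ν, ∀ i, ⟪tensorCoord i (v x), tensorCoord i (u x)⟫_ℂ = 0 := by
  let : TopologicalSpace ι := ⊥
  have : DiscreteTopology ι := ⟨rfl⟩
  let : MeasurableSpace ι := ⊤
  have hfint := integrable_inner_tensorCoord hu hv hu2 hv2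
  have hθ' : Continuous fun p : E × ι => θ p.2 p.1 := continuous_prod_of_discrete_right.2 hθ
  -- By Fubini and Parseval, the integral over `E × ι` against the character of `y` is the integral
  -- of `⟪v x, (T y x ⊗ I) (u x)⟫`, which vanishes by `h`.
  have hzero := ae_eq_zero_of_forall_integral_fourierChar (Γ := Γ) (ν.prod Measure.count) hθ'
    (fun p q hpq => by
      obtain ⟨h1, h2⟩ := hsep _ _ _ _ hpq
      exact Prod.ext h1 h2) hfint (fun y hy => by
      have hint : Integrable (fun p : E × ι => (Real.fourierChar ⟪θ p.2 p.1, y⟫_ℝ : ℂ) *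
          ⟪tensorCoord p.2 (v p.1), tensorCoord p.2 (u p.1)⟫_ℂ) (ν.prod Measure.count) := by
        refine hfint.bdd_mul (c := 1) ?_ (Eventually.of_forall fun p => (Circle.norm_coe _).le)
        exact (continuous_subtype_val.comp (Real.continuous_fourierChar.comp
          (hθ'.inner continuous_const))).aestronglyMeasurable
      rw [integral_prod _ hint, ← h ⟨y, hy⟩]
      refine integral_congr_ae ?_
      filter_upwards [hint.prod_right_ae] with x hx
      rw [integral_countable hx]
      simp only [count_real_singleton, one_smul]
      exact (hasSum_inner_ampl (hT ⟨y, hy⟩ x) (v x) (u x)).tsum_eq)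
  filter_upwards [Measure.ae_ae_of_ae_prod hzero] with x hx
  exact Measure.ae_count_iff.1 hx

end Orthogonality

/-! ### Coordinatewise orthogonality for `τ`-invariant subspaces. -/

section InvariantSubspaces

variable {n : ℕ} {Γ : Subgroup (Iso n)} {R Ω : Set (EuclideanSpace ℝ (Fin n))}
  {γ : CrossSection Γ}

lemma tau_coeFn (g : Γ) (ξ : L2 Γ Ω) :
    tau γ Ω g ξ =ᵐ[volume.restrict Ω] fun ω => fiberRep γ ω g (ξ ω) :=
  directIntegralOp_coeFn _ (isMeasurableRepField_fiberRep γ (volume.restrict Ω) g) ξ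

lemma integral_inner_fiberRep_eq_zero {W : ClosedSubmodule ℂ (L2 Γ Ω)}
    (hW : IsInvariant (tau γ Ω) W) {ξ η : L2 Γ Ω} (hξ : ξ ∈ W) (hη : η ∈ W.toSubmoduleᗮ) (g : Γ) :
    ∫ ω in Ω, ⟪η ω, fiberRep γ ω g (ξ ω)⟫_ℂ = 0 := by
  have h : ⟪η, tau γ Ω g ξ⟫_ℂ = 0 := Submodule.inner_left_of_mem_orthogonal (hW g ξ hξ) hη
  rw [L2.inner_def] at h
  rw [← h]
  refine integral_congr_ae ?_
  filter_upwards [tau_coeFn (γ := γ) g ξ] with ω hω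
  rw [hω]

/-- Vectors of an invariant subspace and of its orthogonal complement have pointwise orthogonal
coordinates. -/
lemma ae_inner_tensorCoord_eq_zero_of_isInvariant [DecidableEq (pointGroup Γ)]
    (hR : IsFundDomain (dualGroup Γ) R)
    (hΩ : (volume : Measure (EuclideanSpace ℝ (Fin n))).restrict Ω = volume.restrict R)
    {W : ClosedSubmodule ℂ (L2 Γ Ω)} (hW : IsInvariant (tau γ Ω) W) {ξ η : L2 Γ Ω} (hξ : ξ ∈ W)
    (hη : η ∈ W.toSubmoduleᗮ) :
    ∀ᵐ ω ∂volume.restrict Ω, ∀ M : pointGroup Γ,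
      ⟪tensorCoord M (η ω), tensorCoord M (ξ ω)⟫_ℂ = 0 := by
  have := countable_pointGroup hR
  -- The argument runs on the subtype `R`: it is Polish because `R` is open, and the characters
  -- separate points only inside `R`.
  have : PolishSpace R := hR.isOpen.polishSpace
  have hRm := hR.isOpen.measurableSet
  have hmp : MeasurePreserving (Subtype.val : R → EuclideanSpace ℝ (Fin n))
      (volume.comap Subtype.val) (volume.restrict Ω) := by
    rw [hΩ]
    exact measurePreserving_subtype_coe hRm
  have : SigmaFinite ((volume : Measure (EuclideanSpace ℝ (Fin n))).comap
      (Subtype.val : R → EuclideanSpace ℝ (Fin n))) := by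
    refine SigmaFinite.of_map _ hmp.measurable.aemeasurable ?_
    rw [hmp.map_eq]
    infer_instance
  have h := ae_inner_tensorCoord_eq_zero (Γ := Γ) (B := l2Dual Γ)
    (θ := fun (M : pointGroup Γ) (ω : R) => (M : Orth n) ω)
    (fun M => (M : Orth n).continuous.comp continuous_subtype_val)
    (fun x x' M M' hxy => by
      obtain ⟨h1, h2⟩ := eq_of_forall_fourierChar_eq hR x.2 x'.2 hxy
      exact ⟨Subtype.ext h1, h2⟩)
    (T := fun y ω => indRep (chi Γ ω) γ (latticeTranslation y.2 : Γ))
    (fun y x M a => indRep_latticeTranslation γ x y.2 a M)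
    ((Lp.stronglyMeasurable ξ).comp_measurable measurable_subtype_coe)
    ((Lp.stronglyMeasurable η).comp_measurable measurable_subtype_coe)
    ((Lp.memLp ξ).comp_measurePreserving hmp) ((Lp.memLp η).comp_measurePreserving hmp)
    (fun y => by
      have h1 := integral_inner_fiberRep_eq_zero hW hξ hη (latticeTranslation y.2 : Γ)
      rw [← hmp.integral_comp (MeasurableEmbedding.subtype_coe hRm)] at h1
      exact h1)
  have hae : ∀ p : EuclideanSpace ℝ (Fin n) → Prop,
      (∀ᵐ ω : R ∂(volume.comap Subtype.val), p ω) → ∀ᵐ ω ∂volume.restrict Ω, p ω := fun p hp => by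
    rwa [← hmp.map_eq, (MeasurableEmbedding.subtype_coe hRm).ae_map_iff]
  exact hae _ h

end InvariantSubspaces

/-! ### Constant operator fields preserving `W`, and the tensor form of the fibres. -/

lemma isBoundedMeasurableField_const {X H : Type*} [MeasurableSpace X] {μ : Measure X}
    [NormedAddCommGroup H] [InnerProductSpace ℂ H] (T : H →L[ℂ] H) :
    IsBoundedMeasurableField μ fun _ : X => T :=
  ⟨fun _ hξ => T.continuous.comp_aestronglyMeasurable hξ, ‖T‖, Eventually.of_forall fun _ => le_rfl⟩

/-- A constant operator field maps `W` to itself if its matrix coefficients between `W` and the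
orthogonal complement of `W` vanish pointwise. -/
lemma directIntegralOp_const_mem {X H : Type*} [MeasurableSpace X] {μ : Measure X}
    [NormedAddCommGroup H] [InnerProductSpace ℂ H] [CompleteSpace H]
    {W : ClosedSubmodule ℂ (Lp H 2 μ)} {T : H →L[ℂ] H} {ξ : Lp H 2 μ}
    (h : ∀ η ∈ W.toSubmoduleᗮ, ∀ᵐ x ∂μ, ⟪η x, T (ξ x)⟫_ℂ = 0) :
    directIntegralOp _ (isBoundedMeasurableField_const (μ := μ) T) ξ ∈ W := by
  rw [← ClosedSubmodule.mem_toSubmodule_iff, ← Submodule.orthogonal_orthogonal W.toSubmodule,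
    Submodule.mem_orthogonal]
  intro η hη
  rw [L2.inner_def]
  refine integral_eq_zero_of_ae ?_
  filter_upwards [h η hη,
    directIntegralOp_coeFn _ (isBoundedMeasurableField_const (μ := μ) T) ξ] with x h1 h2
  rw [h2]
  exact h1

/-- A closed subspace that is stable under the coordinate projections and under unitary operators
`S i ⊗ I` and `T i ⊗ I` with `S i e_j = e_i` and `T i e_i = e_j` is of the form `l² ⊗ F`. -/
lemma exists_eq_tensorSubspace {ι B : Type*} [DecidableEq ι] [NormedAddCommGroup B]
    [InnerProductSpace ℂ B] [CompleteSpace B]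
    (K : ClosedSubmodule ℂ (HilbertTensor (lp (fun _ : ι => ℂ) 2) B)) (j : ι)
    (S T : ι → (lp (fun _ : ι => ℂ) 2 ≃ₗᵢ[ℂ] lp (fun _ : ι => ℂ) 2))
    (hS : ∀ i, S i (lp.single 2 j 1) = lp.single 2 i 1)
    (hT : ∀ i, T i (lp.single 2 i 1) = lp.single 2 j 1)
    (hcoord : ∀ i, ∀ v ∈ K, basisTensor i (tensorCoord i v) ∈ K)
    (hSK : ∀ i, ∀ v ∈ K, ampl B (S i) v ∈ K) (hTK : ∀ i, ∀ v ∈ K, ampl B (T i) v ∈ K) :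
    ∃ F : ClosedSubmodule ℂ B, K = tensorSubspace (lp (fun _ : ι => ℂ) 2) F := by
  refine ⟨_, eq_tensorSubspace K j hcoord fun i b => ⟨fun h => ?_, fun h => ?_⟩⟩
  · rw [← ampl_basisTensor (hT i)]
    exact hTK i _ h
  · rw [← ampl_basisTensor (hS i)]
    exact hSK i _ h

/-- The constant field of the `i`-th coordinate projection maps `W` into its double orthogonal
complement, which is `W`; preserving `W`, it preserves almost every fibre. -/
lemma IsAssociatedRangeFunction.ae_basisTensor_tensorCoord_mem {X ι B : Type*} [MeasurableSpace X]
    {μ : Measure X} [DecidableEq ι] [NormedAddCommGroup B] [InnerProductSpace ℂ B]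
    [CompleteSpace B] {W : ClosedSubmodule ℂ (Lp (HilbertTensor (lp (fun _ : ι => ℂ) 2) B) 2 μ)}
    {J : X → ClosedSubmodule ℂ (HilbertTensor (lp (fun _ : ι => ℂ) 2) B)}
    (hJ : IsAssociatedRangeFunction W J) {i : ι}
    (hW : ∀ ξ ∈ W, ∀ η ∈ W.toSubmoduleᗮ,
      ∀ᵐ x ∂μ, ⟪tensorCoord i (η x), tensorCoord i (ξ x)⟫_ℂ = 0) :
    ∀ᵐ x ∂μ, ∀ v ∈ J x, basisTensor i (tensorCoord i v) ∈ J x := by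
  refine hJ.ae_mapsTo (isBoundedMeasurableField_const
    ((basisTensor i : B →ₗᵢ[ℂ] _).toContinuousLinearMap ∘L tensorCoord i))
    fun ξ hξ => directIntegralOp_const_mem fun η hη => ?_
  filter_upwards [hW ξ hξ η hη] with x hx
  rw [← hx, inner_tensorCoord_left]
  rfl

/-! ### Range functions of `τ`-invariant subspaces. -/

section InvariantSubspaces

variable {n : ℕ} {Γ : Subgroup (Iso n)} {R Ω : Set (EuclideanSpace ℝ (Fin n))}
  {γ : CrossSection Γ}

lemma isPointwiseOrthogonal_of_isInvariant (hR : IsFundDomain (dualGroup Γ) R)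
    (hΩ : (volume : Measure (EuclideanSpace ℝ (Fin n))).restrict Ω = volume.restrict R)
    {W : ClosedSubmodule ℂ (L2 Γ Ω)} (hW : IsInvariant (tau γ Ω) W) :
    IsPointwiseOrthogonal W := by
  classical
  intro ξ hξ η hη
  filter_upwards [ae_inner_tensorCoord_eq_zero_of_isInvariant hR hΩ hW hξ hη] with ω hω
  refine HasSum.unique (hasSum_inner_tensorCoord (η ω) (ξ ω)) ?_
  simp only [hω]
  exact hasSum_zero

/-- The range functions of an invariant subspace are of the form `l²(Π) ⊗ F` almost everywhere. -/
lemma ae_exists_eq_tensorSubspace (hR : IsFundDomain (dualGroup Γ) R)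
    (hΩ : (volume : Measure (EuclideanSpace ℝ (Fin n))).restrict Ω = volume.restrict R)
    {W : ClosedSubmodule ℂ (L2 Γ Ω)} (hW : IsInvariant (tau γ Ω) W)
    {J : EuclideanSpace ℝ (Fin n) → ClosedSubmodule ℂ (fiber Γ)}
    (hJ : IsAssociatedRangeFunction W J) :
    ∀ᵐ ω ∂volume.restrict Ω, ∃ F : ClosedSubmodule ℂ (l2Dual Γ),
      J ω = tensorSubspace (l2Point Γ) F := by
  classical
  have := countable_pointGroup hR
  have hmove : ∀ g : Γ, ∀ᵐ ω ∂volume.restrict Ω, ∀ v ∈ J ω, fiberRep γ ω g v ∈ J ω := fun g =>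
    hJ.ae_mapsTo (isMeasurableRepField_fiberRep γ (volume.restrict Ω) g) fun ξ hξ => hW g ξ hξ
  have hcoord : ∀ M : pointGroup Γ, ∀ᵐ ω ∂volume.restrict Ω, ∀ v ∈ J ω,
      basisTensor M (tensorCoord M v) ∈ J ω := fun M =>
    hJ.ae_basisTensor_tensorCoord_mem fun ξ hξ η hη => by
      filter_upwards [ae_inner_tensorCoord_eq_zero_of_isInvariant hR hΩ hW hξ hη] with ω hω
      exact hω M
  -- Only the countably many elements `γ(M)` and `γ(M)⁻¹` are needed, so the exceptional sets unite
  -- to a null set.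
  filter_upwards [ae_all_iff.2 hcoord, ae_all_iff.2 fun M => hmove (γ.toFun M),
    ae_all_iff.2 fun M => hmove (γ.toFun M)⁻¹] with ω h1 h2 h3
  exact exists_eq_tensorSubspace (J ω) 1 (fun M => indRep (chi Γ ω) γ (γ.toFun M))
    (fun M => indRep (chi Γ ω) γ (γ.toFun M)⁻¹)
    (fun M => indRep_crossSection_single (chi Γ ω) γ M 1)
    (fun M => indRep_crossSection_inv_single (chi Γ ω) γ M 1) h1 h2 h3

lemma isInvariant_fiberRep_tensorSubspace (γ : CrossSection Γ) (ω : EuclideanSpace ℝ (Fin n))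
    (F : ClosedSubmodule ℂ (l2Dual Γ)) :
    IsInvariant (fiberRep γ ω) (tensorSubspace (l2Point Γ) F) := fun g _ hv =>
  ampl_mem_tensorSubspace F (indRep (chi Γ ω) γ g) hv

lemma isInvariant_tau_directIntegral
    {J : EuclideanSpace ℝ (Fin n) → ClosedSubmodule ℂ (fiber Γ)}
    (hJ : ∀ᵐ ω ∂volume.restrict Ω, IsInvariant (fiberRep γ ω) (J ω)) :
    IsInvariant (tau γ Ω) (directIntegral (volume.restrict Ω) J) :=
  isInvariant_directIntegralRep (isMeasurableRepField_fiberRep γ (volume.restrict Ω)) hJ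

end InvariantSubspaces

end Crystal

/-! ### The main theorem. -/

theorem mainTheorem2 {n : ℕ} (Γ : Subgroup (Crystal.Iso n)) (hΓ : Crystal.IsCrystalGroup Γ)
    (γ : Crystal.CrossSection Γ)
    (R Ω : Set (EuclideanSpace ℝ (Fin n)))
    (hR : Crystal.IsFundDomain (Crystal.dualGroup Γ) R) (hRconvex : Convex ℝ R)
    (hΩ : Crystal.IsFundSet (Crystal.dualGroup Γ) Ω) (hRΩ : R ⊆ Ω) (hΩR : Ω ⊆ closure R) :
    (∀ ω ∈ R, Crystal.IsIrreducible (Crystal.indRep (Crystal.chi Γ ω) γ)) ∧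
    ∀ W : ClosedSubmodule ℂ (Crystal.L2 Γ Ω),
      (Crystal.IsInvariant (Crystal.tau γ Ω) W ↔
        ∃ J : EuclideanSpace ℝ (Fin n) → ClosedSubmodule ℂ (Crystal.fiber Γ),
          Crystal.IsMeasurableRangeFunction (volume.restrict Ω) J ∧
          W = Crystal.directIntegral (volume.restrict Ω) J ∧
          ∀ᵐ ω ∂(volume.restrict Ω), Crystal.IsInvariant (Crystal.fiberRep γ ω) (J ω)) ∧
      (Crystal.IsInvariant (Crystal.tau γ Ω) W ↔
        ∃ J : EuclideanSpace ℝ (Fin n) → ClosedSubmodule ℂ (Crystal.fiber Γ),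
          Crystal.IsMeasurableRangeFunction (volume.restrict Ω) J ∧
          W = Crystal.directIntegral (volume.restrict Ω) J ∧
          ∀ᵐ ω ∂(volume.restrict Ω), ∃ F : ClosedSubmodule ℂ (Crystal.l2Dual Γ),
            J ω = Crystal.tensorSubspace (Crystal.l2Point Γ) F) ∧
      (Crystal.IsInvariant (Crystal.tau γ Ω) W →
        (∃ J : EuclideanSpace ℝ (Fin n) → ClosedSubmodule ℂ (Crystal.fiber Γ),
          Crystal.IsAssociatedRangeFunction W J) ∧
        ∀ J : EuclideanSpace ℝ (Fin n) → ClosedSubmodule ℂ (Crystal.fiber Γ),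
          Crystal.IsAssociatedRangeFunction W J →
          Crystal.IsMeasurableRangeFunction (volume.restrict Ω) J ∧
          W = Crystal.directIntegral (volume.restrict Ω) J ∧
          (∃ h : Crystal.IsBoundedMeasurableField (volume.restrict Ω)
              (fun ω => (J ω).toSubmodule.starProjection),
            W.toSubmodule.starProjection = Crystal.directIntegralOp _ h) ∧
          (∀ᵐ ω ∂(volume.restrict Ω), Crystal.IsInvariant (Crystal.fiberRep γ ω) (J ω)) ∧
          (∀ᵐ ω ∂(volume.restrict Ω), ∃ F : ClosedSubmodule ℂ (Crystal.l2Dual Γ),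
            J ω = Crystal.tensorSubspace (Crystal.l2Point Γ) F) ∧
          ∀ J' : EuclideanSpace ℝ (Fin n) → ClosedSubmodule ℂ (Crystal.fiber Γ),
            Crystal.IsMeasurableRangeFunction (volume.restrict Ω) J' →
            W = Crystal.directIntegral (volume.restrict Ω) J' →
            ∀ᵐ ω ∂(volume.restrict Ω), J' ω = J ω) := by
  have hrestr := Crystal.restrict_fundSet_eq hR hRconvex hRΩ hΩR
  have hPi := Crystal.countable_pointGroup hR
  have hdual := Crystal.countable_dualLattice hR
  have hsep : TopologicalSpace.SeparableSpace (Crystal.fiber Γ) :=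
    Crystal.separableSpace_hilbertTensor (Crystal.pointGroup Γ) (Crystal.dualLattice Γ)
  refine ⟨fun ω hω => Crystal.isIrreducible_indRep hR γ hω, fun W => ?_⟩
  have hrange : Crystal.IsInvariant (Crystal.tau γ Ω) W →
      ∀ J : EuclideanSpace ℝ (Fin n) → ClosedSubmodule ℂ (Crystal.fiber Γ),
        Crystal.IsAssociatedRangeFunction W J →
        Crystal.IsMeasurableRangeFunction (volume.restrict Ω) J ∧
        W = Crystal.directIntegral (volume.restrict Ω) J ∧
        (∃ h : Crystal.IsBoundedMeasurableField (volume.restrict Ω)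
            (fun ω => (J ω).toSubmodule.starProjection),
          W.toSubmodule.starProjection = Crystal.directIntegralOp _ h) ∧
        (∀ᵐ ω ∂(volume.restrict Ω), Crystal.IsInvariant (Crystal.fiberRep γ ω) (J ω)) ∧
        (∀ᵐ ω ∂(volume.restrict Ω), ∃ F : ClosedSubmodule ℂ (Crystal.l2Dual Γ),
          J ω = Crystal.tensorSubspace (Crystal.l2Point Γ) F) := by
    intro hW J hJ
    have horth := Crystal.isPointwiseOrthogonal_of_isInvariant hR hrestr hW
    have htensor := Crystal.ae_exists_eq_tensorSubspace hR hrestr hW hJ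
    have hfield := hJ.isBoundedMeasurableField horth
    refine ⟨hfield.isMeasurableRangeFunction, hJ.eq_directIntegral horth,
      ⟨hfield, hJ.starProjection_eq horth⟩, ?_, htensor⟩
    -- Invariance under all of `Γ` is read off from the tensor form, which avoids a separate null
    -- set for each group element.
    filter_upwards [htensor] with ω ⟨F, hF⟩
    rw [hF]
    exact Crystal.isInvariant_fiberRep_tensorSubspace γ ω F
  refine ⟨⟨fun hW => ?_, ?_⟩, ⟨fun hW => ?_, ?_⟩, fun hW =>
    ⟨Crystal.exists_isAssociatedRangeFunction W, fun J hJ => ?_⟩⟩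
  · obtain ⟨J, hJ⟩ := Crystal.exists_isAssociatedRangeFunction W
    obtain ⟨h1, h2, -, h3, -⟩ := hrange hW J hJ
    exact ⟨J, h1, h2, h3⟩
  · rintro ⟨J, -, rfl, hJ⟩
    exact Crystal.isInvariant_tau_directIntegral hJ
  · obtain ⟨J, hJ⟩ := Crystal.exists_isAssociatedRangeFunction W
    obtain ⟨h1, h2, -, -, h3⟩ := hrange hW J hJ
    exact ⟨J, h1, h2, h3⟩
  · rintro ⟨J, -, rfl, hJ⟩
    refine Crystal.isInvariant_tau_directIntegral ?_
    filter_upwards [hJ] with ω ⟨F, hF⟩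
    rw [hF]
    exact Crystal.isInvariant_fiberRep_tensorSubspace γ ω F
  · obtain ⟨h1, h2, h3, h4, h5⟩ := hrange hW J hJ
    refine ⟨h1, h2, h3, h4, h5, fun J' hJ' hWJ' => ?_⟩
    filter_upwards [Crystal.ae_le_of_directIntegral_le h1 (h2.symm.trans hWJ').le,
      Crystal.ae_le_of_directIntegral_le hJ' (hWJ'.symm.trans h2).le] with ω hle hge
    exact le_antisymm hge hle
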